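/- **Conventions.** Let $n,m,d\ge 1$ be integers, $1<p<\infty$, $p'=p/(p-1)$. For $A\in M_d(\mathbb{C})$, $|A|$ is the operator norm (largest singular value), and for $e\in\mathbb{C}^d$, $|e|$ is the Euclidean norm. Averages are written $\langle f\rangle_E=\frac1{|E|}\int_E f$. A *dyadic grid in $\mathbb{R}$* is a collection $\bigcup_{k\in\mathbb{Z}}\mathcal{D}_k$ where each $\mathcal{D}_k$ is a partition of $\mathbb{R}$ into intervals $[a,a+2^{-k})$ and every interval of $\mathcal{D}_k$ is the union of exactly two intervals of $\mathcal{D}_{k+1}$. A *dyadic grid in $\mathbb{R}^n$* consists of all cubes $I_1\times\dots\times I_n$ with $I_i\in\mathcal{D}^i$ and $|I_1|=\dots=|I_n|=2^{-k}$, $k\in\mathbb{Z}$, for some dyadic grids $\mathcal{D}^1,\dots,\mathcal{D}^n$ in $\mathbb{R}$. A *product dyadic grid* in $\mathbb{R}^n\times\mathbb{R}^m$ is $\boldsymbol{\mathcal{D}}=\{R_1\times R_2: R_1\in\mathcal{D}^1,\ R_2\in\mathcal{D}^2\}$ with $\mathcal{D}^1,\mathcal{D}^2$ dyadic grids in $\mathbb{R}^n,\mathbb{R}^m$.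 A *$d\times d$ matrix weight* on $\mathbb{R}^n\times\mathbb{R}^m$ is a locally integrable $W:\mathbb{R}^n\times\mathbb{R}^m\to M_d(\mathbb{C})$ with $W(x)$ positive definite for a.e. $x$; put $W'=W^{-1/(p-1)}$. It is a *$\boldsymbol{\mathcal{D}}$-dyadic biparameter $A_p$ weight* if $$[W]_{A_p,\boldsymbol{\mathcal{D}}}=\sup_{R\in\boldsymbol{\mathcal{D}}}\frac1{|R|}\int_R\Big(\frac1{|R|}\int_R|W(x)^{1/p}W(y)^{-1/p}|^{p'}\,dy\Big)^{p/p'}dx<\infty .$$ A *reducing operator* of $W$ over $R$ with respect to the exponent $p$ is a positive definite $\mathcal{W}_R\in M_d(\mathbb{C})$ with $$\Big(\frac1{|R|}\int_R|W(x)^{1/p}e|^p\,dx\Big)^{1/p}\le|\mathcal{W}_Re|\le\sqrt d\,\Big(\frac1{|R|}\int_R|W(x)^{1/p}e|^p\,dx\Big)^{1/p}\qquad\text{for all } e\in\mathbb{C}^d .$$ **Norms.** Let $U,V$ be matrix weights on $\mathbb{R}^n\times\mathbb{R}^m$ and $B:\mathbb{R}^n\times\mathbb{R}^m\to M_d(\mathbb{C})$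 locally integrable. For chosen reducing operators $\mathcal{U}_R,\mathcal{V}_R$ of $U,V$ over $R\in\boldsymbol{\mathcal{D}}$ with respect to $p$, define in $[0,\infty]$ $$\|B\|_{\mathrm{bmo}_{\boldsymbol{\mathcal{D}}}(U,V,p)}=\sup_{R\in\boldsymbol{\mathcal{D}}}\Big(\frac1{|R|}\int_R|V(x)^{1/p}(B(x)-\langle B\rangle_R)\,\mathcal{U}_R^{-1}|^p\,dx\Big)^{1/p},$$ $$\|B\|_{\widetilde{\mathrm{bmo}}_{\boldsymbol{\mathcal{D}}}(U,V,p)}=\sup_{R\in\boldsymbol{\mathcal{D}}}\frac1{|R|}\int_R|\mathcal{V}_R(B(x)-\langle B\rangle_R)\,\mathcal{U}_R^{-1}|\,dx,$$ $$\|B\|_{\mathrm{bmo}^1_{\boldsymbol{\mathcal{D}}}(U,V,p)}=\sup_{R\in\boldsymbol{\mathcal{D}}}\Big(\frac1{|R|}\int_R\Big(\frac1{|R|}\int_R|V(x)^{1/p}(B(x)-B(y))U(y)^{-1/p}|^{p'}\,dy\Big)^{p/p'}dx\Big)^{1/p},$$ $$\|B\|_{\mathrm{bmo}^2_{\boldsymbol{\mathcal{D}}}(U,V,p)}=\sup_{R\in\boldsymbol{\mathcal{D}}}\Big(\frac1{|R|}\int_R\Big(\frac1{|R|}\int_R|V(x)^{1/p}(B(x)-B(y))U(y)^{-1/p}|^{p}\,dx\Big)^{p'/p}dy\Big)^{1/p'}.$$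 The norms with data $(V',U',p')$ are formed in the same way, with reducing operators of $V'$ and $U'$ with respect to the exponent $p'$; $B^*$ is the pointwise adjoint of $B$. **Proposition.** Let $\boldsymbol{\mathcal{D}}$ be a product dyadic grid in $\mathbb{R}^n\times\mathbb{R}^m$, let $U,V$ be $\boldsymbol{\mathcal{D}}$-dyadic biparameter $d\times d$ matrix $A_p$ weights, and let $B:\mathbb{R}^n\times\mathbb{R}^m\to M_d(\mathbb{C})$ be locally integrable. Then, for every choice of the reducing operators, $$\|B\|_{\mathrm{bmo}_{\boldsymbol{\mathcal{D}}}(U,V,p)}\sim\|B^*\|_{\mathrm{bmo}_{\boldsymbol{\mathcal{D}}}(V',U',p')}\sim\|B\|_{\widetilde{\mathrm{bmo}}_{\boldsymbol{\mathcal{D}}}(U,V,p)}\sim\|B^*\|_{\widetilde{\mathrm{bmo}}_{\boldsymbol{\mathcal{D}}}(V',U',p')}$$ and $$\|B\|_{\mathrm{bmo}_{\boldsymbol{\mathcal{D}}}(U,V,p)}\sim\|B\|_{\mathrm{bmo}^1_{\boldsymbol{\mathcal{D}}}(U,V,p)}\sim\|B\|_{\mathrm{bmo}^2_{\boldsymbol{\mathcal{D}}}(U,V,p)}.$$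 Here $a\sim b$ means $a\le Cb$ and $b\le Ca$ in $[0,\infty]$ (so one side is infinite exactly when the other is), with a finite constant $C$ that depends only on $n,m,p,d,[U]_{A_p,\boldsymbol{\mathcal{D}}}$ and $[V]_{A_p,\boldsymbol{\mathcal{D}}}$. -/

import Mathlib

open MeasureTheory Set
open scoped ENNReal NNReal Matrix ComplexOrder Matrix.Norms.L2Operator

namespace MatrixBMO

noncomputable section

/-! ### Dyadic grids -/

/-- A dyadic grid in `ℝ`: a union of generations `G k`, `k ∈ ℤ`, each of which is a partition of
`ℝ` into left-closed right-open intervals of length `2⁻ᵏ`, and such that every interval of `G k` is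
the union of exactly two intervals of `G (k + 1)`. -/
def IsDyadicGridReal (D : Set (Set ℝ)) : Prop :=
  ∃ G : ℤ → Set (Set ℝ), D = ⋃ k, G k ∧
    (∀ k, Setoid.IsPartition (G k)) ∧
    (∀ k, ∀ I ∈ G k, ∃ a : ℝ, I = Ico a (a + (2 : ℝ) ^ (-k))) ∧
    (∀ k, ∀ J ∈ G k, ∃ I₁ ∈ G (k + 1), ∃ I₂ ∈ G (k + 1), I₁ ≠ I₂ ∧ J = I₁ ∪ I₂)

/-- A dyadic grid in `ℝⁿ`: all cubes `I₁ × ⋯ × Iₙ` with `Iᵢ` in the `i`-th of `n` given dyadic grids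
in `ℝ`, all the `Iᵢ` having the same length `2⁻ᵏ` for some `k ∈ ℤ`. -/
def IsDyadicGrid {n : ℕ} (D : Set (Set (Fin n → ℝ))) : Prop :=
  ∃ G : Fin n → Set (Set ℝ), (∀ i, IsDyadicGridReal (G i)) ∧
    D = ⋃ k : ℤ, {Q | ∃ I : Fin n → Set ℝ,
      (∀ i, I i ∈ G i ∧ volume (I i) = ENNReal.ofReal ((2 : ℝ) ^ (-k))) ∧ Q = Set.univ.pi I}

/-- The rectangles `R₁ × R₂` with `R₁ ∈ D₁` and `R₂ ∈ D₂`. -/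
def productGrid {n m : ℕ} (D₁ : Set (Set (Fin n → ℝ))) (D₂ : Set (Set (Fin m → ℝ))) :
    Set (Set ((Fin n → ℝ) × (Fin m → ℝ))) :=
  {R | ∃ R₁ ∈ D₁, ∃ R₂ ∈ D₂, R = R₁ ×ˢ R₂}

/-! ### Matrix weights

Matrices carry the operator norm (the largest singular value), vectors the Euclidean norm. -/

/-- The real power `Aˢ` of a positive definite matrix, by functional calculus. -/
def mpow {d : ℕ} (A : Matrix (Fin d) (Fin d) ℂ) (s : ℝ) : Matrix (Fin d) (Fin d) ℂ :=
  cfc (fun t : ℝ => t ^ s) A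

variable {n m d : ℕ}

/-- A matrix weight on `ℝⁿ × ℝᵐ`: locally integrable and a.e. positive definite. -/
def IsMatrixWeight (W : (Fin n → ℝ) × (Fin m → ℝ) → Matrix (Fin d) (Fin d) ℂ) : Prop :=
  LocallyIntegrable W volume ∧ ∀ᵐ x, (W x).PosDef

/-- The dual weight `W' = W^{-1/(p-1)}`. -/
def dualWeight (p : ℝ) (W : (Fin n → ℝ) × (Fin m → ℝ) → Matrix (Fin d) (Fin d) ℂ) :
    (Fin n → ℝ) × (Fin m → ℝ) → Matrix (Fin d) (Fin d) ℂ :=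
  fun x => mpow (W x) (-1 / (p - 1))

/-- The dyadic biparameter characteristic `[W]_{A_p, D}`; here `p' = p / (p - 1)` is
`p.conjExponent`. -/
def apChar (D : Set (Set ((Fin n → ℝ) × (Fin m → ℝ)))) (p : ℝ)
    (W : (Fin n → ℝ) × (Fin m → ℝ) → Matrix (Fin d) (Fin d) ℂ) : ℝ≥0∞ :=
  ⨆ R ∈ D, ⨍⁻ x in R, (⨍⁻ y in R,
    ‖mpow (W x) (1 / p) * mpow (W y) (-1 / p)‖ₑ ^ p.conjExponent ∂volume) ^ (p / p.conjExponent) ∂volume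

/-- `W` is a `D`-dyadic biparameter matrix `A_p` weight. -/
def IsDyadicAp (D : Set (Set ((Fin n → ℝ) × (Fin m → ℝ)))) (p : ℝ)
    (W : (Fin n → ℝ) × (Fin m → ℝ) → Matrix (Fin d) (Fin d) ℂ) : Prop :=
  IsMatrixWeight W ∧ apChar D p W < ∞

/-- `A` is a reducing operator of `W` over `E` with respect to the exponent `p`. -/
def IsReducingOperator (p : ℝ) (W : (Fin n → ℝ) × (Fin m → ℝ) → Matrix (Fin d) (Fin d) ℂ)
    (E : Set ((Fin n → ℝ) × (Fin m → ℝ))) (A : Matrix (Fin d) (Fin d) ℂ) : Prop :=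
  A.PosDef ∧ ∀ e : EuclideanSpace ℂ (Fin d),
    (⨍⁻ x in E, ‖Matrix.toEuclideanCLM (𝕜 := ℂ) (mpow (W x) (1 / p)) e‖ₑ ^ p ∂volume) ^ (1 / p)
        ≤ ‖Matrix.toEuclideanCLM (𝕜 := ℂ) A e‖ₑ ∧
    ‖Matrix.toEuclideanCLM (𝕜 := ℂ) A e‖ₑ ≤ ENNReal.ofReal (Real.sqrt d) *
      (⨍⁻ x in E, ‖Matrix.toEuclideanCLM (𝕜 := ℂ) (mpow (W x) (1 / p)) e‖ₑ ^ p ∂volume) ^ (1 / p)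

/-- `𝒲` assigns to every `R ∈ D` a reducing operator of `W` over `R` with respect to `p`. -/
def IsReducingFamily (D : Set (Set ((Fin n → ℝ) × (Fin m → ℝ)))) (p : ℝ)
    (W : (Fin n → ℝ) × (Fin m → ℝ) → Matrix (Fin d) (Fin d) ℂ)
    (𝒲 : Set ((Fin n → ℝ) × (Fin m → ℝ)) → Matrix (Fin d) (Fin d) ℂ) : Prop :=
  ∀ R ∈ D, IsReducingOperator p W R (𝒲 R)

/-! ### The little BMO norms -/

/-- `‖B‖_{bmo_D(U,V,p)}`, where `𝒰 R` is the chosen reducing operator of `U` over `R`. -/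
def bmo (D : Set (Set ((Fin n → ℝ) × (Fin m → ℝ)))) (p : ℝ)
    (𝒰 : Set ((Fin n → ℝ) × (Fin m → ℝ)) → Matrix (Fin d) (Fin d) ℂ)
    (V B : (Fin n → ℝ) × (Fin m → ℝ) → Matrix (Fin d) (Fin d) ℂ) : ℝ≥0∞ :=
  ⨆ R ∈ D, (⨍⁻ x in R,
    ‖mpow (V x) (1 / p) * (B x - ⨍ y in R, B y ∂volume) * (𝒰 R)⁻¹‖ₑ ^ p ∂volume) ^ (1 / p)

/-- The norm of `B` in the tilde variant of `bmo_D(U,V,p)`, where `𝒰 R` and `𝒱 R` are the chosen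
reducing operators of `U` and `V` over `R`. -/
def bmoTilde (D : Set (Set ((Fin n → ℝ) × (Fin m → ℝ))))
    (𝒰 𝒱 : Set ((Fin n → ℝ) × (Fin m → ℝ)) → Matrix (Fin d) (Fin d) ℂ)
    (B : (Fin n → ℝ) × (Fin m → ℝ) → Matrix (Fin d) (Fin d) ℂ) : ℝ≥0∞ :=
  ⨆ R ∈ D, ⨍⁻ x in R, ‖𝒱 R * (B x - ⨍ y in R, B y ∂volume) * (𝒰 R)⁻¹‖ₑ ∂volume

/-- `‖B‖_{bmo¹_D(U,V,p)}`. -/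
def bmoOne (D : Set (Set ((Fin n → ℝ) × (Fin m → ℝ)))) (p : ℝ)
    (U V B : (Fin n → ℝ) × (Fin m → ℝ) → Matrix (Fin d) (Fin d) ℂ) : ℝ≥0∞ :=
  ⨆ R ∈ D, (⨍⁻ x in R, (⨍⁻ y in R,
    ‖mpow (V x) (1 / p) * (B x - B y) * mpow (U y) (-1 / p)‖ₑ ^ p.conjExponent ∂volume)
      ^ (p / p.conjExponent) ∂volume) ^ (1 / p)

/-- `‖B‖_{bmo²_D(U,V,p)}`. -/
def bmoTwo (D : Set (Set ((Fin n → ℝ) × (Fin m → ℝ)))) (p : ℝ)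
    (U V B : (Fin n → ℝ) × (Fin m → ℝ) → Matrix (Fin d) (Fin d) ℂ) : ℝ≥0∞ :=
  ⨆ R ∈ D, (⨍⁻ y in R, (⨍⁻ x in R,
    ‖mpow (V x) (1 / p) * (B x - B y) * mpow (U y) (-1 / p)‖ₑ ^ p ∂volume)
      ^ (p.conjExponent / p) ∂volume) ^ (1 / p.conjExponent)

/-- `a` and `b` are comparable with the constant `C`; in particular, one of them is infinite if and
only if the other one is. -/
def Comparable (C : ℝ≥0) (a b : ℝ≥0∞) : Prop := a ≤ C * b ∧ b ≤ C * a

end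

end MatrixBMO

/-! On one rectangle R, let A and A' be reducing operators of W (exponent p) and of W' (exponent
p'). Hölder's inequality always makes A'⁻¹A⁻¹ bounded; the A_p condition is used only to bound AA'.
Hence A and A'⁻¹ are interchangeable in norms. `IsDualPair` records exactly this, symmetrically in
the weight and its dual, and `isDualPair_of_isReducingOperator` derives it from the A_p condition.

Most of the comparisons then take place on a single R. Exchanging operators in this way and taking
adjoints relates the two tilde norms. Hölder bounds a tilde norm by the corresponding `bmo` norm,
and a `bmo` norm by the double oscillation. Splitting B(x) - B(y) through the mean bounds the double
oscillation by the `bmo` norms of B and of its adjoint.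

The substantial step is the reverse bound of `bmo` by its tilde variant, a John–Nirenberg inequality
(`lpAvg_cell_truncated_le`). Below R, stop at the maximal cells where the average of the reduced
oscillation exceeds twice the tilde norm. Before and at stopping the averages of B have jumped by a
controlled amount. The stopped cells cover at most half of R, and by the A_∞ property of ‖U^{1/p}M‖ᵖ
(`IsDualPair.setLIntegral_le_smallMassConst`) they carry at most a fraction δ < 1 of its integral.
Bounding the oscillation of V^{1/p}BM by the norm of U^{1/p}M, for any constant matrix M, turns the
recursion into K = K₀ + δ^{1/p}K, with no comparison of reducing operators on different cells.
Lebesgue differentiation and Fatou's lemma remove the truncation.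

The product structure enters only through `exists_cellTree`: halving both factors of R at once gives
a one-parameter tree of rectangles in the grid, with parent-to-child measure ratio 2^{n+m} whatever
the eccentricity of R. -/

namespace MatrixBMO

/-! ### Real powers of positive definite matrices. -/

section MatrixPowers

variable {d : ℕ}

lemma isSelfAdjoint_mpow (A : Matrix (Fin d) (Fin d) ℂ) (s : ℝ) : star (mpow A s) = mpow A s :=
  (cfc_predicate (fun t : ℝ => t ^ s) A : IsSelfAdjoint _)

open scoped MatrixOrder in
lemma spectrum_pos_of_posDef {A : Matrix (Fin d) (Fin d) ℂ} (hA : A.PosDef) :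
    spectrum ℝ A ⊆ Ioi 0 :=
  fun _ ht => hA.isStrictlyPositive.spectrum_pos ht

lemma continuousOn_rpow_pos (s : ℝ) : ContinuousOn (fun t : ℝ => t ^ s) (Ioi 0) :=
  fun t ht => (Real.continuousAt_rpow_const t s (Or.inl (ne_of_gt ht))).continuousWithinAt

lemma mpow_mul_mpow_neg {A : Matrix (Fin d) (Fin d) ℂ} (hA : A.PosDef) (s : ℝ) :
    mpow A s * mpow A (-s) = 1 := by
  have hs := spectrum_pos_of_posDef hA
  have hsa : IsSelfAdjoint A := hA.isHermitian
  unfold mpow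
  rw [← cfc_mul _ _ A ((continuousOn_rpow_pos s).mono hs) ((continuousOn_rpow_pos (-s)).mono hs),
    ← cfc_one ℝ A]
  refine cfc_congr fun t ht => ?_
  have ht' : 0 < t := hs ht
  simp only [Pi.one_apply]
  rw [← Real.rpow_add ht']; simp

lemma mpow_mpow {A : Matrix (Fin d) (Fin d) ℂ} (hA : A.PosDef) (s t : ℝ) :
    mpow (mpow A s) t = mpow A (s * t) := by
  have hs := spectrum_pos_of_posDef hA
  have hsa : IsSelfAdjoint A := hA.isHermitian
  unfold mpow
  rw [← cfc_comp' (fun x : ℝ => x ^ t) (fun x : ℝ => x ^ s) A ?_ ((continuousOn_rpow_pos s).mono hs)]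
  · refine cfc_congr fun x hx => ?_
    have hx' : 0 < x := hs hx
    exact (Real.rpow_mul hx'.le s t).symm
  · refine (continuousOn_rpow_pos t).mono ?_
    rintro _ ⟨x, hx, rfl⟩
    exact Real.rpow_pos_of_pos (hs hx) s

/-- The power is continuous only where the spectrum stays in (0, ∞). That set of self-adjoint
matrices is Borel, by upper hemicontinuity of the spectrum, so the power extended by 0 off it is a
Borel function to compose with W. -/
lemma aestronglyMeasurable_mpow {X : Type*} [MeasurableSpace X] {μ : Measure X}
    {W : X → Matrix (Fin d) (Fin d) ℂ} (hW : AEStronglyMeasurable W μ)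
    (hpos : ∀ᵐ x ∂μ, (W x).PosDef) (s : ℝ) :
    AEStronglyMeasurable (fun x => mpow (W x) s) μ := by
  classical
  let _ : MeasurableSpace (Matrix (Fin d) (Fin d) ℂ) := borel _
  have _ : BorelSpace (Matrix (Fin d) (Fin d) ℂ) := ⟨rfl⟩
  set S : Set (Matrix (Fin d) (Fin d) ℂ) :=
    {A | IsSelfAdjoint A} ∩ {A | Ioi (0 : ℝ) ∈ nhdsSet (spectrum ℝ A)} with hS
  have hSmeas : MeasurableSet S := by
    refine (isClosed_eq continuous_star continuous_id).measurableSet.inter ?_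
    exact ((upperHemicontinuous_spectrum ℝ (Matrix (Fin d) (Fin d) ℂ)).isOpen _).measurableSet
  have hcont : ContinuousOn (fun A : Matrix (Fin d) (Fin d) ℂ => mpow A s) S := by
    refine ContinuousOn.cfc_of_mem_nhdsSet (s := Ioi (0 : ℝ)) _ ?_ continuousOn_id
      (fun A hA => hA.1) (continuousOn_rpow_pos s)
    rw [nhdsSet_iUnion]
    simp only [nhdsSet_iUnion, Filter.mem_iSup]
    exact fun A hA => hA.2
  have hF : Measurable (S.piecewise (fun A => mpow A s) (fun _ => 0)) :=
    hcont.measurable_piecewise continuousOn_const hSmeas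
  refine ⟨fun x => S.piecewise (fun A => mpow A s) (fun _ => 0) (hW.mk W x),
    (hF.comp hW.stronglyMeasurable_mk.measurable).stronglyMeasurable, ?_⟩
  filter_upwards [hW.ae_eq_mk, hpos] with x hx hx'
  rw [← hx, Set.piecewise_eq_of_mem]
  exact ⟨hx'.isHermitian, (isOpen_Ioi.mem_nhdsSet).2 (spectrum_pos_of_posDef hx')⟩

end MatrixPowers

/-! ### Operator norms of products and of columns. -/

section MatrixNorms

variable {d : ℕ}

lemma enorm_mul_le' (M N : Matrix (Fin d) (Fin d) ℂ) : ‖M * N‖ₑ ≤ ‖M‖ₑ * ‖N‖ₑ := by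
  rw [← ofReal_norm, ← ofReal_norm, ← ofReal_norm, ← ENNReal.ofReal_mul (norm_nonneg _)]
  exact ENNReal.ofReal_le_ofReal (norm_mul_le _ _)

lemma enorm_star' (M : Matrix (Fin d) (Fin d) ℂ) : ‖star M‖ₑ = ‖M‖ₑ := by
  rw [← ofReal_norm, ← ofReal_norm, norm_star]

lemma enorm_one_le : ‖(1 : Matrix (Fin d) (Fin d) ℂ)‖ₑ ≤ 1 := by
  rw [← ofReal_norm, ENNReal.ofReal_le_one, Matrix.cstar_norm_def, map_one]
  exact ContinuousLinearMap.norm_id_le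

/-- The product of self-adjoint matrices has the same norm in the two orders. -/
lemma enorm_mul_comm_of_star {M N : Matrix (Fin d) (Fin d) ℂ} (hM : star M = M)
    (hN : star N = N) : ‖M * N‖ₑ = ‖N * M‖ₑ := by
  rw [← enorm_star' (M * N), star_mul, hM, hN]

lemma enorm_toEuclideanCLM_le (M : Matrix (Fin d) (Fin d) ℂ) (e : EuclideanSpace ℂ (Fin d)) :
    ‖Matrix.toEuclideanCLM (𝕜 := ℂ) M e‖ₑ ≤ ‖M‖ₑ * ‖e‖ₑ := by
  rw [← ofReal_norm, ← ofReal_norm, ← ofReal_norm, ← ENNReal.ofReal_mul (norm_nonneg _)]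
  exact ENNReal.ofReal_le_ofReal ((Matrix.toEuclideanCLM (𝕜 := ℂ) M).le_opNorm e)

lemma enorm_toEuclideanCLM_single_le (M : Matrix (Fin d) (Fin d) ℂ) (j : Fin d) :
    ‖Matrix.toEuclideanCLM (𝕜 := ℂ) M (EuclideanSpace.single j 1)‖ₑ ≤ ‖M‖ₑ := by
  refine (enorm_toEuclideanCLM_le M _).trans ?_
  rw [← ofReal_norm (EuclideanSpace.single j (1 : ℂ))]
  simp

/-- Expand a vector in the standard basis; each coordinate is at most its norm. This is how bounds
on vectors, as in the definition of a reducing operator, become bounds on matrices. -/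
lemma enorm_le_sum_columns (M : Matrix (Fin d) (Fin d) ℂ) :
    ‖M‖ₑ ≤ ∑ j, ‖Matrix.toEuclideanCLM (𝕜 := ℂ) M (EuclideanSpace.single j 1)‖ₑ := by
  have h : ‖M‖ ≤ ∑ j, ‖Matrix.toEuclideanCLM (𝕜 := ℂ) M (EuclideanSpace.single j 1)‖ := by
    rw [Matrix.cstar_norm_def]
    refine ContinuousLinearMap.opNorm_le_bound _ (by positivity) fun e => ?_
    have he : e = ∑ j, e j • EuclideanSpace.single j (1 : ℂ) := by
      ext i
      simp [Finset.sum_apply, Pi.single_apply]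
    conv_lhs => rw [he]
    rw [map_sum, Finset.sum_mul]
    refine (norm_sum_le _ _).trans (Finset.sum_le_sum fun j _ => ?_)
    rw [map_smul, norm_smul, mul_comm]
    exact mul_le_mul_of_nonneg_left (PiLp.norm_apply_le e j) (norm_nonneg _)
  simp only [← ofReal_norm]
  rw [← ENNReal.ofReal_sum_of_nonneg fun _ _ => norm_nonneg _]
  exact ENNReal.ofReal_le_ofReal h

end MatrixNorms

/-! ### Lᵖ norms of functions with values in [0, ∞]. -/

section LpAvg

variable {X : Type*} [MeasurableSpace X] {ν : Measure X} {p q : ℝ} {f g : X → ℝ≥0∞}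

/-- The `Lᵖ` norm of a nonnegative function. -/
noncomputable def lpAvg (ν : Measure X) (p : ℝ) (f : X → ℝ≥0∞) : ℝ≥0∞ :=
  (∫⁻ x, f x ^ p ∂ν) ^ (1 / p)

lemma lpAvg_mono_ae (hp : 0 < p) (h : ∀ᵐ x ∂ν, f x ≤ g x) : lpAvg ν p f ≤ lpAvg ν p g := by
  refine ENNReal.rpow_le_rpow (lintegral_mono_ae ?_) (by positivity)
  filter_upwards [h] with x hx using ENNReal.rpow_le_rpow hx hp.le

lemma lpAvg_mono (hp : 0 < p) (h : ∀ x, f x ≤ g x) : lpAvg ν p f ≤ lpAvg ν p g :=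
  lpAvg_mono_ae hp (Filter.Eventually.of_forall h)

lemma lpAvg_congr_ae (h : ∀ᵐ x ∂ν, f x = g x) : lpAvg ν p f = lpAvg ν p g := by
  unfold lpAvg
  congr 1
  refine lintegral_congr_ae ?_
  filter_upwards [h] with x hx
  rw [hx]

lemma lpAvg_const_mul (hp : 0 < p) (hf : AEMeasurable f ν) (c : ℝ≥0∞) :
    lpAvg ν p (fun x => c * f x) = c * lpAvg ν p f := by
  unfold lpAvg
  simp only [ENNReal.mul_rpow_of_nonneg _ _ hp.le]
  rw [lintegral_const_mul'' _ (hf.pow_const p), ENNReal.mul_rpow_of_nonneg _ _ (by positivity),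
    ← ENNReal.rpow_mul, mul_one_div_cancel hp.ne', ENNReal.rpow_one]

/-- A finite constant needs no measurability of f; this serves when f is itself an inner norm x ↦
‖·‖ in y. -/
lemma lpAvg_const_mul' (hp : 0 < p) {c : ℝ≥0∞} (hc : c ≠ ∞) (f : X → ℝ≥0∞) :
    lpAvg ν p (fun x => c * f x) = c * lpAvg ν p f := by
  unfold lpAvg
  simp only [ENNReal.mul_rpow_of_nonneg _ _ hp.le]
  rw [lintegral_const_mul' _ _ (by finiteness), ENNReal.mul_rpow_of_nonneg _ _ (by positivity),
    ← ENNReal.rpow_mul, mul_one_div_cancel hp.ne', ENNReal.rpow_one]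

lemma lpAvg_rpow (hp : 0 < p) : lpAvg ν p f ^ p = ∫⁻ x, f x ^ p ∂ν := by
  rw [lpAvg, ← ENNReal.rpow_mul, one_div_mul_cancel hp.ne', ENNReal.rpow_one]

lemma lpAvg_add_le (hp : 1 ≤ p) (hf : AEMeasurable f ν) (hg : AEMeasurable g ν) :
    lpAvg ν p (fun x => f x + g x) ≤ lpAvg ν p f + lpAvg ν p g :=
  ENNReal.lintegral_Lp_add_le hf hg hp

lemma lpAvg_sum_le {ι : Type*} (s : Finset ι) (hp : 1 ≤ p) {F : ι → X → ℝ≥0∞}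
    (hF : ∀ i, AEMeasurable (F i) ν) :
    lpAvg ν p (fun x => ∑ i ∈ s, F i x) ≤ ∑ i ∈ s, lpAvg ν p (F i) := by
  classical
  have hp0 : 0 < p := by linarith
  induction s using Finset.induction_on with
  | empty => simp [lpAvg, hp0]
  | insert i s his IH =>
    simp only [Finset.sum_insert his]
    exact (lpAvg_add_le hp (hF i) (Finset.aemeasurable_fun_sum s fun j _ => hF j)).trans
      (by gcongr)

lemma lintegral_mul_le_lpAvg (hpq : p.HolderConjugate q) (hf : AEMeasurable f ν)
    (hg : AEMeasurable g ν) : ∫⁻ x, f x * g x ∂ν ≤ lpAvg ν p f * lpAvg ν q g :=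
  ENNReal.lintegral_mul_le_Lp_mul_Lq ν hpq hf hg

end LpAvg

/-! ### A weight and its dual on one probability space. -/

section DualPairs

variable {X : Type*} [MeasurableSpace X] {d : ℕ}

lemma enorm_mul_sub_integral_mul_le {ν : Measure X} [IsProbabilityMeasure ν]
    {B : X → Matrix (Fin d) (Fin d) ℂ} (hB : Integrable B ν) (b P R : Matrix (Fin d) (Fin d) ℂ) :
    ‖P * (b - ∫ y, B y ∂ν) * R‖ₑ ≤ ∫⁻ y, ‖P * (b - B y) * R‖ₑ ∂ν := by
  have hint : Integrable (fun y => b - B y) ν := (integrable_const _).sub hB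
  have h2 : b - ∫ y, B y ∂ν = ∫ y, (b - B y) ∂ν := by
    rw [integral_sub (integrable_const _) hB]; simp
  have h3 := (ContinuousLinearMap.mul ℝ (Matrix (Fin d) (Fin d) ℂ) P).integral_comp_comm hint
  have h4 := ((ContinuousLinearMap.mul ℝ (Matrix (Fin d) (Fin d) ℂ)).flip
    R).integral_comp_comm (hint.const_mul P)
  simp only [ContinuousLinearMap.mul_apply', ContinuousLinearMap.flip_apply] at h3 h4
  rw [h2, ← h3, ← h4]
  exact enorm_integral_le_lintegral_enorm _

lemma enorm_mul_integral_sub_mul_le {ν : Measure X} [IsProbabilityMeasure ν]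
    {B : X → Matrix (Fin d) (Fin d) ℂ} (hB : Integrable B ν) (b P R : Matrix (Fin d) (Fin d) ℂ) :
    ‖P * ((∫ y, B y ∂ν) - b) * R‖ₑ ≤ ∫⁻ y, ‖P * (B y - b) * R‖ₑ ∂ν := by
  have h : ∀ a : Matrix (Fin d) (Fin d) ℂ, ‖P * (a - b) * R‖ₑ = ‖P * (b - a) * R‖ₑ := fun a => by
    rw [← enorm_neg, ← neg_mul, ← mul_neg, neg_sub]
  simp only [h]
  exact enorm_mul_sub_integral_mul_le hB b P R

/-- Over a probability measure `ν`, the a.e. mutually inverse functions `w = W^{1/p}` and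
`w' = W^{-1/p}` have the reducing operators `A` and `A'`, with all the constants at most `c`. -/
structure IsDualPair (ν : Measure X) (p q : ℝ) (c : ℝ≥0) (w w' : X → Matrix (Fin d) (Fin d) ℂ)
    (A A' : Matrix (Fin d) (Fin d) ℂ) : Prop where
  holder : p.HolderConjugate q
  meas : AEStronglyMeasurable w ν
  meas' : AEStronglyMeasurable w' ν
  star_w : ∀ x, star (w x) = w x
  star_w' : ∀ x, star (w' x) = w' x
  mul_inv : ∀ᵐ x ∂ν, w x * w' x = 1
  star_A : star A = A
  star_A' : star A' = A'
  inv_A : A * A⁻¹ = 1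
  inv_A' : A' * A'⁻¹ = 1
  le_A : ∀ M, lpAvg ν p (fun x => ‖w x * M‖ₑ) ≤ c * ‖A * M‖ₑ
  A_le : ∀ M, ‖A * M‖ₑ ≤ c * lpAvg ν p (fun x => ‖w x * M‖ₑ)
  le_A' : ∀ M, lpAvg ν q (fun x => ‖w' x * M‖ₑ) ≤ c * ‖A' * M‖ₑ
  A'_le : ∀ M, ‖A' * M‖ₑ ≤ c * lpAvg ν q (fun x => ‖w' x * M‖ₑ)
  -- The only field that comes from the A_p condition.
  mul_le : ‖A * A'‖ₑ ≤ c

namespace IsDualPair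

variable {ν : Measure X} {p q : ℝ} {c cU : ℝ≥0}
  {w w' u u' B : X → Matrix (Fin d) (Fin d) ℂ} {A A' U U' b : Matrix (Fin d) (Fin d) ℂ}

lemma symm (h : IsDualPair ν p q c w w' A A') : IsDualPair ν q p c w' w A' A where
  holder := h.holder.symm
  meas := h.meas'
  meas' := h.meas
  star_w := h.star_w'
  star_w' := h.star_w
  mul_inv := by
    filter_upwards [h.mul_inv] with x hx using mul_eq_one_comm.1 hx
  star_A := h.star_A'
  star_A' := h.star_A
  inv_A := h.inv_A'
  inv_A' := h.inv_A
  le_A := h.le_A'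
  A_le := h.A'_le
  le_A' := h.le_A
  A'_le := h.A_le
  mul_le := by rw [enorm_mul_comm_of_star h.star_A' h.star_A]; exact h.mul_le

lemma star_inv (h : IsDualPair ν p q c w w' A A') : star A⁻¹ = A⁻¹ := by
  rw [Matrix.star_eq_conjTranspose, Matrix.conjTranspose_nonsing_inv,
    ← Matrix.star_eq_conjTranspose, h.star_A]

lemma lpAvg_mul_inv_le (h : IsDualPair ν p q c w w' A A') :
    lpAvg ν p (fun x => ‖w x * A⁻¹‖ₑ) ≤ c := by
  refine (h.le_A A⁻¹).trans ?_
  rw [h.inv_A]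
  exact mul_le_of_le_one_right' enorm_one_le

lemma aemeasurable_mul (h : IsDualPair ν p q c w w' A A') (M : Matrix (Fin d) (Fin d) ℂ) :
    AEMeasurable (fun x => ‖w x * M‖ₑ) ν :=
  (h.meas.mul_const M).enorm

/-- Write A'⁻¹F = (A'⁻¹w')(wF) and apply Hölder; the first factor is normalized by the reducing
property. Allowing a smaller measure μ gives the A_∞ property when μ is a restriction. -/
lemma lintegral_inv_mul_le (h : IsDualPair ν p q c w w' A A') {μ : Measure X} (hμ : μ ≤ ν)
    {F : X → Matrix (Fin d) (Fin d) ℂ} (hF : AEStronglyMeasurable F ν) :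
    ∫⁻ x, ‖A'⁻¹ * F x‖ₑ ∂μ ≤ c * lpAvg μ p (fun x => ‖w x * F x‖ₑ) := by
  have hac : μ ≪ ν := Measure.absolutelyContinuous_of_le hμ
  have hm : AEMeasurable (fun x => ‖w x * F x‖ₑ) μ := ((h.meas.mul hF).enorm).mono_ac hac
  calc ∫⁻ x, ‖A'⁻¹ * F x‖ₑ ∂μ
      ≤ ∫⁻ x, ‖w' x * A'⁻¹‖ₑ * ‖w x * F x‖ₑ ∂μ := by
        refine lintegral_mono_ae ?_
        filter_upwards [hac.ae_le h.symm.mul_inv] with x hx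
        have : A'⁻¹ * F x = (A'⁻¹ * w' x) * (w x * F x) := by
          rw [mul_assoc, ← mul_assoc (w' x), hx, one_mul]
        rw [this, enorm_mul_comm_of_star (h.star_w' x) h.symm.star_inv]
        exact enorm_mul_le' _ _
    _ ≤ lpAvg μ q (fun x => ‖w' x * A'⁻¹‖ₑ) * lpAvg μ p (fun x => ‖w x * F x‖ₑ) :=
        lintegral_mul_le_lpAvg h.holder.symm ((h.symm.aemeasurable_mul _).mono_ac hac) hm
    _ ≤ c * lpAvg μ p (fun x => ‖w x * F x‖ₑ) := by
        gcongr
        refine le_trans ?_ h.symm.lpAvg_mul_inv_le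
        exact ENNReal.rpow_le_rpow (lintegral_mono' hμ le_rfl)
          (by have := h.holder.symm.pos; positivity)

/-- The half of the comparison of A with A'⁻¹ that rests on the A_p condition; the other half,
`enorm_inv_mul_inv_le`, is Hölder alone. -/
lemma enorm_mul_le (h : IsDualPair ν p q c w w' A A') (M : Matrix (Fin d) (Fin d) ℂ) :
    ‖A * M‖ₑ ≤ c * ‖A'⁻¹ * M‖ₑ := by
  have : A * M = (A * A') * (A'⁻¹ * M) := by
    rw [mul_assoc, ← mul_assoc A', h.inv_A', one_mul]
  rw [this]
  exact (enorm_mul_le' _ _).trans (by gcongr; exact h.mul_le)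

lemma lintegral_mul_le (h : IsDualPair ν p q c w w' A A')
    {F : X → Matrix (Fin d) (Fin d) ℂ} (hF : AEStronglyMeasurable F ν) :
    ∫⁻ x, ‖A * F x‖ₑ ∂ν ≤ c * c * lpAvg ν p (fun x => ‖w x * F x‖ₑ) :=
  calc ∫⁻ x, ‖A * F x‖ₑ ∂ν ≤ ∫⁻ x, c * ‖A'⁻¹ * F x‖ₑ ∂ν :=
        lintegral_mono fun x => h.enorm_mul_le _
    _ = c * ∫⁻ x, ‖A'⁻¹ * F x‖ₑ ∂ν := lintegral_const_mul' _ _ ENNReal.coe_ne_top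
    _ ≤ c * (c * lpAvg ν p (fun x => ‖w x * F x‖ₑ)) := by
        gcongr
        exact h.lintegral_inv_mul_le le_rfl hF
    _ = _ := by ring

lemma enorm_inv_mul_inv_le [IsProbabilityMeasure ν] (h : IsDualPair ν p q c w w' A A') :
    ‖A'⁻¹ * A⁻¹‖ₑ ≤ c * c := by
  have := h.lintegral_inv_mul_le (μ := ν) le_rfl (F := fun _ => A⁻¹)
    aestronglyMeasurable_const
  rw [lintegral_const, measure_univ, mul_one] at this
  exact this.trans (by gcongr; exact h.lpAvg_mul_inv_le)

/-- The `A_∞` property of `‖w M‖ᵖ`. -/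
lemma lpAvg_mul_measure_le (h : IsDualPair ν p q c w w' A A')
    (M : Matrix (Fin d) (Fin d) ℂ) (F : Set X) :
    lpAvg ν p (fun x => ‖w x * M‖ₑ) * ν F
      ≤ c ^ 3 * lpAvg (ν.restrict F) p (fun x => ‖w x * M‖ₑ) := by
  have := h.lintegral_inv_mul_le (Measure.restrict_le_self (s := F)) (F := fun _ => M)
    aestronglyMeasurable_const
  rw [lintegral_const, Measure.restrict_apply_univ] at this
  calc lpAvg ν p (fun x => ‖w x * M‖ₑ) * ν F ≤ (c * (c * ‖A'⁻¹ * M‖ₑ)) * ν F := by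
        gcongr
        exact (h.le_A M).trans (by gcongr; exact h.enorm_mul_le M)
    _ = c ^ 2 * (‖A'⁻¹ * M‖ₑ * ν F) := by ring
    _ ≤ c ^ 2 * (c * lpAvg (ν.restrict F) p (fun x => ‖w x * M‖ₑ)) := by gcongr
    _ = _ := by ring

/-- Passage from `𝒱, 𝒰⁻¹` to the dual pair `𝒱'⁻¹, 𝒰'`. -/
lemma enorm_dual_le [IsProbabilityMeasure ν] (h : IsDualPair ν p q c w w' A A')
    (hU : IsDualPair ν p q cU u u' U U') (N : Matrix (Fin d) (Fin d) ℂ) :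
    ‖U' * star N * A'⁻¹‖ₑ ≤ c * c * cU * ‖A * N * U⁻¹‖ₑ := by
  have h1 : ‖U' * star N * A'⁻¹‖ₑ = ‖A'⁻¹ * N * U'‖ₑ := by
    rw [← enorm_star' (U' * star N * A'⁻¹), star_mul, star_mul, star_star, h.symm.star_inv,
      hU.star_A', mul_assoc]
  have h2 : A'⁻¹ * N * U' = (A'⁻¹ * A⁻¹) * (A * N * U⁻¹) * (U * U') := by
    simp only [mul_assoc]
    rw [← mul_assoc A⁻¹ A, mul_eq_one_comm.1 h.inv_A, one_mul, ← mul_assoc U⁻¹ U,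
      mul_eq_one_comm.1 hU.inv_A, one_mul]
  rw [h1, h2]
  calc _ ≤ ‖A'⁻¹ * A⁻¹‖ₑ * ‖A * N * U⁻¹‖ₑ * ‖U * U'‖ₑ :=
        (enorm_mul_le' _ _).trans (by gcongr; exact enorm_mul_le' _ _)
    _ ≤ (c * c) * ‖A * N * U⁻¹‖ₑ * cU := by
        gcongr
        · exact h.enorm_inv_mul_inv_le
        · exact hU.mul_le
    _ = _ := by ring

lemma enorm_mul_dual_le (hU : IsDualPair ν p q cU u u' U U') (N : Matrix (Fin d) (Fin d) ℂ) :
    ‖N * U'‖ₑ ≤ cU * ‖N * U⁻¹‖ₑ := by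
  have : N * U' = (N * U⁻¹) * (U * U') := by
    rw [mul_assoc, ← mul_assoc U⁻¹, mul_eq_one_comm.1 hU.inv_A, one_mul]
  rw [this, mul_comm (cU : ℝ≥0∞)]
  exact (enorm_mul_le' _ _).trans (by gcongr; exact hU.mul_le)

lemma lpAvg_right_le (hU : IsDualPair ν p q cU u u' U U') (N : Matrix (Fin d) (Fin d) ℂ) :
    lpAvg ν q (fun y => ‖N * u' y‖ₑ) ≤ cU * ‖N * U'‖ₑ := by
  have h1 : ∀ y, ‖N * u' y‖ₑ = ‖u' y * star N‖ₑ := fun y => by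
    rw [← enorm_star' (N * u' y), star_mul, hU.star_w']
  have h2 : ‖N * U'‖ₑ = ‖U' * star N‖ₑ := by
    rw [← enorm_star' (N * U'), star_mul, hU.star_A']
  simp only [h1, h2]
  exact hU.le_A' _

/-- The oscillation against the mean is controlled by the double oscillation. -/
lemma lpAvg_sub_mean_le [IsProbabilityMeasure ν] (hU : IsDualPair ν p q cU u u' U U')
    (hB : Integrable B ν) (w : X → Matrix (Fin d) (Fin d) ℂ) :
    lpAvg ν p (fun x => ‖w x * (B x - ∫ y, B y ∂ν) * U⁻¹‖ₑ)
      ≤ cU * lpAvg ν p (fun x => lpAvg ν q (fun y => ‖w x * (B x - B y) * u' y‖ₑ)) := by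
  have hp := hU.holder.pos
  have key : ∀ x, ‖w x * (B x - ∫ y, B y ∂ν) * U⁻¹‖ₑ
      ≤ cU * lpAvg ν q (fun y => ‖w x * (B x - B y) * u' y‖ₑ) := by
    intro x
    have hint : Integrable (fun y => B x - B y) ν := (integrable_const _).sub hB
    calc _ ≤ ∫⁻ y, ‖w x * (B x - B y) * U⁻¹‖ₑ ∂ν := enorm_mul_sub_integral_mul_le hB _ _ _
      -- Insert u'(y)u(y) = 1 before U⁻¹, which prepares Hölder in y.
      _ ≤ ∫⁻ y, ‖u y * U⁻¹‖ₑ * ‖w x * (B x - B y) * u' y‖ₑ ∂ν := by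
          refine lintegral_mono_ae ?_
          filter_upwards [hU.symm.mul_inv] with y hy
          have : w x * (B x - B y) * U⁻¹ = (w x * (B x - B y) * u' y) * (u y * U⁻¹) := by
            rw [mul_assoc _ (u' y), ← mul_assoc (u' y), hy, one_mul]
          rw [this, mul_comm ‖u y * U⁻¹‖ₑ]
          exact enorm_mul_le' _ _
      _ ≤ lpAvg ν p (fun y => ‖u y * U⁻¹‖ₑ) * lpAvg ν q (fun y => ‖w x * (B x - B y) * u' y‖ₑ) :=
          lintegral_mul_le_lpAvg hU.holder (hU.aemeasurable_mul _)
            ((hint.aestronglyMeasurable.const_mul _).mul hU.meas').enorm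
      _ ≤ _ := by gcongr; exact hU.lpAvg_mul_inv_le
  exact (lpAvg_mono hp key).trans (lpAvg_const_mul' hp ENNReal.coe_ne_top _).le

/-- The double oscillation is controlled by the oscillations of `B` and of its adjoint. -/
lemma lpAvg_lpAvg_le (h : IsDualPair ν p q c w w' A A')
    (hU : IsDualPair ν p q cU u u' U U') (hB : AEStronglyMeasurable B ν)
    (b : Matrix (Fin d) (Fin d) ℂ) :
    lpAvg ν p (fun x => lpAvg ν q (fun y => ‖w x * (B x - B y) * u' y‖ₑ))
      ≤ cU * cU * lpAvg ν p (fun x => ‖w x * (B x - b) * U⁻¹‖ₑ)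
        + c * c * lpAvg ν q (fun y => ‖u' y * (star (B y) - star b) * A'⁻¹‖ₑ) := by
  have hp := h.holder.pos
  have hq := h.holder.symm.pos
  set T := lpAvg ν q (fun y => ‖u' y * (star (B y) - star b) * A'⁻¹‖ₑ) with hT
  have hBb : AEStronglyMeasurable (fun x => B x - b) ν := hB.sub aestronglyMeasurable_const
  have hsB : AEStronglyMeasurable (fun x => star (B x) - star b) ν :=
    (continuous_star.comp_aestronglyMeasurable hB).sub aestronglyMeasurable_const
  have hV : lpAvg ν q (fun y => ‖A * (b - B y) * u' y‖ₑ) ≤ c * T := by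
    have m0 : AEMeasurable (fun y => ‖u' y * (star (B y) - star b) * A'⁻¹‖ₑ) ν :=
      ((hU.meas'.mul hsB).mul_const _).enorm
    rw [hT, ← lpAvg_const_mul hq m0]
    refine lpAvg_mono hq fun y => ?_
    have h1 : ‖A * (b - B y) * u' y‖ₑ = ‖u' y * (star (B y) - star b) * A‖ₑ := by
      rw [← enorm_star' (A * (b - B y) * u' y), star_mul, star_mul, h.star_A, hU.star_w', star_sub,
        ← enorm_neg, ← mul_neg, ← neg_mul, neg_sub, mul_assoc]
    rw [h1]
    exact h.symm.enorm_mul_dual_le _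
  have inner : ∀ x, lpAvg ν q (fun y => ‖w x * (B x - B y) * u' y‖ₑ)
      ≤ cU * cU * ‖w x * (B x - b) * U⁻¹‖ₑ + (c * T) * ‖w x * A⁻¹‖ₑ := by
    intro x
    have m1 : AEMeasurable (fun y => ‖w x * (B x - b) * u' y‖ₑ) ν :=
      (hU.meas'.const_mul _).enorm
    have m2 : AEMeasurable (fun y => ‖A * (b - B y) * u' y‖ₑ) ν :=
      (((aestronglyMeasurable_const.sub hB).const_mul A).mul hU.meas').enorm
    calc _ ≤ lpAvg ν q (fun y => ‖w x * (B x - b) * u' y‖ₑ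
              + ‖w x * A⁻¹‖ₑ * ‖A * (b - B y) * u' y‖ₑ) := by
          refine lpAvg_mono hq fun y => ?_
          -- Split at b and insert A⁻¹A in the second term: it then factors into a function of x
          -- times a function of y.
          have : w x * (B x - B y) * u' y = w x * (B x - b) * u' y
              + (w x * A⁻¹) * (A * (b - B y) * u' y) := by
            simp only [mul_assoc]
            rw [← mul_assoc A⁻¹ A, mul_eq_one_comm.1 h.inv_A, one_mul, ← mul_add,
              ← add_mul, sub_add_sub_cancel]
          rw [this]
          exact (enorm_add_le _ _).trans (by gcongr; exact enorm_mul_le' _ _)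
      _ ≤ lpAvg ν q (fun y => ‖w x * (B x - b) * u' y‖ₑ)
            + ‖w x * A⁻¹‖ₑ * lpAvg ν q (fun y => ‖A * (b - B y) * u' y‖ₑ) := by
          refine (lpAvg_add_le h.holder.symm.lt.le m1 (m2.const_mul _)).trans ?_
          rw [lpAvg_const_mul hq m2]
      _ ≤ cU * (cU * ‖w x * (B x - b) * U⁻¹‖ₑ) + ‖w x * A⁻¹‖ₑ * (c * T) := by
          gcongr
          exact (hU.lpAvg_right_le _).trans (by gcongr; exact hU.enorm_mul_dual_le _)
      _ = _ := by ring
  refine (lpAvg_mono hp inner).trans ?_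
  have m3 : AEMeasurable (fun x => ‖w x * (B x - b) * U⁻¹‖ₑ) ν :=
    ((h.meas.mul hBb).mul_const _).enorm
  refine (lpAvg_add_le h.holder.lt.le (m3.const_mul _)
    ((h.aemeasurable_mul _).const_mul _)).trans ?_
  rw [lpAvg_const_mul hp m3, lpAvg_const_mul hp (h.aemeasurable_mul _)]
  refine add_le_add_right ?_ _
  calc _ ≤ c * T * c := by gcongr; exact h.lpAvg_mul_inv_le
    _ = _ := by ring

end IsDualPair

/-! ### Averages over a set. -/

section NormalizedRestriction

variable {μ : Measure X} {Q : Set X}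

/-- The restriction of `μ` to `Q`, normalized to a probability measure. -/
noncomputable def avgMeasure (μ : Measure X) (Q : Set X) : Measure X :=
  (μ.restrict Q univ)⁻¹ • μ.restrict Q

lemma avgMeasure_eq (μ : Measure X) (Q : Set X) : avgMeasure μ Q = (μ Q)⁻¹ • μ.restrict Q := by
  rw [avgMeasure, Measure.restrict_apply_univ]

lemma isProbabilityMeasure_avgMeasure (h0 : μ Q ≠ 0) (h1 : μ Q ≠ ∞) :
    IsProbabilityMeasure (avgMeasure μ Q) := by
  refine ⟨?_⟩
  rw [avgMeasure_eq, Measure.smul_apply, Measure.restrict_apply_univ, smul_eq_mul,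
    ENNReal.inv_mul_cancel h0 h1]

lemma avgMeasure_absolutelyContinuous : avgMeasure μ Q ≪ μ.restrict Q := by
  rw [avgMeasure_eq]
  exact Measure.smul_absolutelyContinuous

lemma absolutelyContinuous_avgMeasure (h1 : μ Q ≠ ∞) : μ.restrict Q ≪ avgMeasure μ Q := by
  rw [avgMeasure_eq]
  exact Measure.absolutelyContinuous_smul (ENNReal.inv_ne_zero.2 h1)

lemma integrable_avgMeasure {E : Type*} [NormedAddCommGroup E] {f : X → E} (h0 : μ Q ≠ 0)
    (hf : IntegrableOn f Q μ) : Integrable f (avgMeasure μ Q) := by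
  rw [avgMeasure_eq]
  exact hf.smul_measure (ENNReal.inv_ne_top.2 h0)

lemma lintegral_avgMeasure (f : X → ℝ≥0∞) :
    ∫⁻ x, f x ∂(avgMeasure μ Q) = (μ Q)⁻¹ * ∫⁻ x in Q, f x ∂μ := by
  rw [avgMeasure_eq, lintegral_smul_measure, smul_eq_mul]

lemma lpAvg_restrict_eq {p : ℝ} (hp : 0 < p) (h0 : μ Q ≠ 0) (h1 : μ Q ≠ ∞) {F : Set X}
    (hFm : MeasurableSet F) (hF : F ⊆ Q) (f : X → ℝ≥0∞) :
    lpAvg (μ.restrict F) p f = μ Q ^ (1 / p) * lpAvg ((avgMeasure μ Q).restrict F) p f := by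
  unfold lpAvg
  rw [avgMeasure_eq, Measure.restrict_smul, Measure.restrict_restrict hFm,
    inter_eq_self_of_subset_left hF, lintegral_smul_measure, smul_eq_mul,
    ← ENNReal.mul_rpow_of_nonneg _ _ (by positivity), ← mul_assoc, ENNReal.mul_inv_cancel h0 h1,
    one_mul]

lemma lpAvg_restrict_self_eq {p : ℝ} (hp : 0 < p) (h0 : μ Q ≠ 0) (h1 : μ Q ≠ ∞)
    (f : X → ℝ≥0∞) :
    lpAvg (μ.restrict Q) p f = μ Q ^ (1 / p) * lpAvg (avgMeasure μ Q) p f := by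
  unfold lpAvg
  rw [avgMeasure_eq, lintegral_smul_measure, smul_eq_mul,
    ← ENNReal.mul_rpow_of_nonneg _ _ (by positivity), ← mul_assoc, ENNReal.mul_inv_cancel h0 h1,
    one_mul]

end NormalizedRestriction

/-! ### Cell trees and stopping times. -/

/-- Nested countable measurable partitions of `X`; `c k x` is the cell of generation `k` containing
`x`, and a cell has at most `Λ` times the measure of each of its children. -/
structure IsCellTree (μ : Measure X) (c : ℕ → X → Set X) (Λ : ℝ≥0) : Prop where
  mem : ∀ k x, x ∈ c k x
  eq_of_mem : ∀ k x y, y ∈ c k x → c k y = c k x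
  succ_subset : ∀ k x, c (k + 1) x ⊆ c k x
  measurableSet : ∀ k x, MeasurableSet (c k x)
  countable_range : ∀ k, (range (c k)).Countable
  measure_ne_zero : ∀ k x, μ (c k x) ≠ 0
  measure_ne_top : ∀ k x, μ (c k x) ≠ ∞
  measure_le : ∀ k x, μ (c k x) ≤ Λ * μ (c (k + 1) x)

namespace IsCellTree

variable {μ : Measure X} {c : ℕ → X → Set X} {Λ : ℝ≥0}

lemma antitone (hc : IsCellTree μ c Λ) (x : X) : Antitone fun k => c k x :=
  antitone_nat_of_succ_le fun k => hc.succ_subset k x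

lemma eq_of_mem_of_le (hc : IsCellTree μ c Λ) {k l : ℕ} (hkl : k ≤ l) {x y : X}
    (hy : y ∈ c l x) : c k y = c k x :=
  hc.eq_of_mem k x y (hc.antitone x hkl hy)

/-- A choice of cells `c (τ x) x` that partition the space. -/
def IsStopping (c : ℕ → X → Set X) (τ : X → ℕ) : Prop :=
  ∀ x, ∀ y ∈ c (τ x) x, τ y = τ x

lemma IsStopping.cell_eq (hc : IsCellTree μ c Λ) {τ : X → ℕ} (hτ : IsStopping c τ) {x y : X}
    (hy : y ∈ c (τ x) x) : c (τ y) y = c (τ x) x := by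
  rw [hτ x y hy, hc.eq_of_mem _ _ _ hy]

lemma countable_range_stopped (hc : IsCellTree μ c Λ) (τ : X → ℕ) :
    (range fun x => c (τ x) x).Countable := by
  refine (countable_iUnion hc.countable_range).mono ?_
  rintro _ ⟨x, rfl⟩
  exact mem_iUnion.2 ⟨τ x, x, rfl⟩

/-- E is the union of its stopped cells, of which there are only countably many. -/
lemma measurableSet_of_saturated (hc : IsCellTree μ c Λ) {τ : X → ℕ} {E : Set X}
    (hE : ∀ x ∈ E, c (τ x) x ⊆ E) : MeasurableSet E := by
  have : E = ⋃ Q ∈ (fun x => c (τ x) x) '' E, Q := by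
    ext x
    simp only [mem_image, iUnion_exists, biUnion_and', iUnion_iUnion_eq_right, mem_iUnion,
      exists_prop]
    exact ⟨fun hx => ⟨x, hx, hc.mem _ x⟩, fun ⟨y, hy, hxy⟩ => hE y hy hxy⟩
  rw [this]
  refine MeasurableSet.biUnion ((hc.countable_range_stopped τ).mono (image_subset_range _ _)) ?_
  rintro _ ⟨x, -, rfl⟩
  exact hc.measurableSet _ _

lemma stronglyMeasurable_stopped (hc : IsCellTree μ c Λ) {τ : X → ℕ} (hτ : IsStopping c τ)
    {E : Type*} [TopologicalSpace E] [TopologicalSpace.PseudoMetrizableSpace E]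
    [SecondCountableTopology E] (ψ : Set X → E) :
    StronglyMeasurable fun x => ψ (c (τ x) x) := by
  borelize E
  refine Measurable.stronglyMeasurable fun T _ => ?_
  refine hc.measurableSet_of_saturated (τ := τ) fun x hx y hy => ?_
  simp only [mem_preimage] at hx ⊢
  rwa [hτ.cell_eq hc hy]

/-- Stopped cells are equal or disjoint, so both integrals are countable sums over the cells in E.
-/
lemma setLIntegral_mono_of_cells (hc : IsCellTree μ c Λ) {τ : X → ℕ} (hτ : IsStopping c τ)
    {E : Set X} (hE : ∀ x ∈ E, c (τ x) x ⊆ E) {g h : X → ℝ≥0∞}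
    (hgh : ∀ x ∈ E, ∫⁻ y in c (τ x) x, g y ∂μ ≤ ∫⁻ y in c (τ x) x, h y ∂μ) :
    ∫⁻ y in E, g y ∂μ ≤ ∫⁻ y in E, h y ∂μ := by
  set 𝓕 := (fun x => c (τ x) x) '' E with h𝓕
  have hU : E = ⋃ Q ∈ 𝓕, Q := by
    ext x
    simp only [h𝓕, mem_image, iUnion_exists, biUnion_and', iUnion_iUnion_eq_right, mem_iUnion,
      exists_prop]
    exact ⟨fun hx => ⟨x, hx, hc.mem _ x⟩, fun ⟨y, hy, hxy⟩ => hE y hy hxy⟩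
  have hcount : 𝓕.Countable := (hc.countable_range_stopped τ).mono (image_subset_range _ _)
  have hmeas : ∀ Q ∈ 𝓕, MeasurableSet Q := by
    rintro _ ⟨x, -, rfl⟩
    exact hc.measurableSet _ _
  have hdisj : 𝓕.PairwiseDisjoint id := by
    rintro _ ⟨x, -, rfl⟩ _ ⟨y, -, rfl⟩ hne
    refine Set.disjoint_left.2 fun z hz hz' => hne ?_
    exact (hτ.cell_eq hc hz).symm.trans (hτ.cell_eq hc hz')
  rw [hU, lintegral_biUnion hcount hmeas hdisj, lintegral_biUnion hcount hmeas hdisj]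
  refine ENNReal.tsum_le_tsum ?_
  rintro ⟨_, x, hx, rfl⟩
  exact hgh x hx

/-- The maximal cells below `c i x` with the property `S`, completed to a partition by cells of
generation `N`. -/
lemma exists_stopping (hc : IsCellTree μ c Λ) {i N : ℕ} (hiN : i < N) (x : X)
    (S : Set X → Prop) (hS : ¬ S (c i x)) :
    ∃ τ : X → ℕ, IsStopping c τ ∧ ∀ z ∈ c i x,
      i < τ z ∧ τ z ≤ N ∧ ¬ S (c (τ z - 1) z) ∧ (¬ S (c (τ z) z) → τ z = N) := by
  classical
  -- The stopping time is the first generation from i on at which S holds, capped at N.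
  have hex : ∀ z, ∃ j, i ≤ j ∧ (S (c j z) ∨ N ≤ j) := fun z => ⟨N, hiN.le, Or.inr le_rfl⟩
  refine ⟨fun z => Nat.find (hex z), ?_, ?_⟩
  · intro z y hy
    have h1 : Nat.find (hex y) ≤ Nat.find (hex z) := by
      refine Nat.find_min' _ ?_
      rw [hc.eq_of_mem _ _ _ hy]
      exact Nat.find_spec (hex z)
    refine le_antisymm h1 (Nat.find_min' _ ?_)
    rw [← hc.eq_of_mem_of_le h1 hy]
    exact Nat.find_spec (hex y)
  · intro z hz
    have hspec := Nat.find_spec (hex z)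
    have hle : Nat.find (hex z) ≤ N := Nat.find_min' _ ⟨hiN.le, Or.inr le_rfl⟩
    have hlt : i < Nat.find (hex z) := by
      refine lt_of_le_of_ne hspec.1 fun h => ?_
      rw [← h, hc.eq_of_mem _ _ _ hz] at hspec
      exact hspec.2.elim hS fun h' => by omega
    have hmin : ¬ (i ≤ Nat.find (hex z) - 1 ∧ (S (c (Nat.find (hex z) - 1) z) ∨
        N ≤ Nat.find (hex z) - 1)) := Nat.find_min (hex z) (by omega)
    exact ⟨hlt, hle, fun h => hmin ⟨by omega, Or.inl h⟩,
      fun h => le_antisymm hle (hspec.2.resolve_left h)⟩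

end IsCellTree

/-! ### The A_∞ property of a matrix weight. -/

section AInfty

variable {μ : Measure X} {Q : Set X} {p q : ℝ} {c : ℝ≥0}
  {w w' : X → Matrix (Fin d) (Fin d) ℂ} {A A' : Matrix (Fin d) (Fin d) ℂ}

/-- The constant of the `A_∞` property: the loss `δ < 1` of mass on small sets. -/
noncomputable def smallMassConst (p : ℝ) (c : ℝ≥0) : ℝ≥0 :=
  (2 * c ^ 3) ^ p / ((2 * c ^ 3) ^ p + 1)

lemma smallMassConst_lt_one (p : ℝ) (c : ℝ≥0) : smallMassConst p c < 1 := by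
  unfold smallMassConst
  rw [div_lt_one (by positivity)]
  exact lt_add_one _

lemma IsDualPair.setLIntegral_le_smallMassConst
    (h : IsDualPair (avgMeasure μ Q) p q c w w' A A') (h0 : μ Q ≠ 0) (h1 : μ Q ≠ ∞)
    (hQ : MeasurableSet Q) {E : Set X} (hE : MeasurableSet E) (hEQ : E ⊆ Q)
    (hsmall : 2 * μ E ≤ μ Q) (M : Matrix (Fin d) (Fin d) ℂ) :
    ∫⁻ x in E, ‖w x * M‖ₑ ^ p ∂μ ≤ smallMassConst p c * ∫⁻ x in Q, ‖w x * M‖ₑ ^ p ∂μ := by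
  have hp := h.holder.pos
  set F := Q \ E with hF
  have hFm : MeasurableSet F := hQ.diff hE
  have hQEF : μ Q = μ E + μ F := by
    rw [hF, measure_add_sdiff hE.nullMeasurableSet, union_eq_self_of_subset_left hEQ]
  have hEfin : μ E ≠ ∞ := ne_top_of_le_ne_top h1 (measure_mono hEQ)
  have hEF : μ E ≤ μ F := by
    rw [hQEF, two_mul] at hsmall
    exact (ENNReal.add_le_add_iff_left hEfin).1 hsmall
  have hF2 : 1 ≤ 2 * avgMeasure μ Q F := by
    rw [avgMeasure_eq, Measure.smul_apply, Measure.restrict_apply hFm,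
      inter_eq_self_of_subset_left sdiff_subset, smul_eq_mul, mul_left_comm,
      ← ENNReal.inv_mul_cancel h0 h1]
    gcongr
    rw [hQEF, two_mul]
    gcongr
  have hmain : lpAvg (μ.restrict Q) p (fun x => ‖w x * M‖ₑ)
      ≤ 2 * c ^ 3 * lpAvg (μ.restrict F) p (fun x => ‖w x * M‖ₑ) := by
    rw [lpAvg_restrict_self_eq hp h0 h1, lpAvg_restrict_eq hp h0 h1 hFm sdiff_subset]
    calc _ ≤ μ Q ^ (1 / p) * (lpAvg (avgMeasure μ Q) p (fun x => ‖w x * M‖ₑ)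
              * (2 * avgMeasure μ Q F)) := by
          gcongr
          exact le_mul_of_one_le_right' hF2
      _ = 2 * μ Q ^ (1 / p) * (lpAvg (avgMeasure μ Q) p (fun x => ‖w x * M‖ₑ)
              * avgMeasure μ Q F) := by ring
      _ ≤ 2 * μ Q ^ (1 / p) * (c ^ 3 * lpAvg ((avgMeasure μ Q).restrict F) p
              (fun x => ‖w x * M‖ₑ)) := by
          exact mul_le_mul_right (h.lpAvg_mul_measure_le M F) _
      _ = _ := by ring
  set C₀ : ℝ≥0 := (2 * c ^ 3) ^ p with hC₀
  have hpow : ∫⁻ x in Q, ‖w x * M‖ₑ ^ p ∂μ ≤ C₀ * ∫⁻ x in F, ‖w x * M‖ₑ ^ p ∂μ := by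
    have := ENNReal.rpow_le_rpow hmain hp.le
    rw [ENNReal.mul_rpow_of_nonneg _ _ hp.le, lpAvg_rpow hp, lpAvg_rpow hp] at this
    refine this.trans_eq ?_
    rw [hC₀, ENNReal.coe_rpow_of_nonneg _ hp.le]
    push_cast
    rfl
  have hsplit : ∫⁻ x in Q, ‖w x * M‖ₑ ^ p ∂μ
      = ∫⁻ x in E, ‖w x * M‖ₑ ^ p ∂μ + ∫⁻ x in F, ‖w x * M‖ₑ ^ p ∂μ := by
    rw [← lintegral_union hFm disjoint_sdiff_right, union_sdiff_cancel hEQ]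
  -- From ∫_E ≤ C₀ ∫_F, add C₀ ∫_E to both sides: no subtraction, so the integrals may be infinite.
  have hfin : (∫⁻ x in E, ‖w x * M‖ₑ ^ p ∂μ) * (C₀ + 1 : ℝ≥0)
      ≤ C₀ * ∫⁻ x in Q, ‖w x * M‖ₑ ^ p ∂μ := by
    have hle : ∫⁻ x in E, ‖w x * M‖ₑ ^ p ∂μ ≤ C₀ * ∫⁻ x in F, ‖w x * M‖ₑ ^ p ∂μ :=
      (lintegral_mono_set hEQ).trans hpow
    rw [hsplit, ENNReal.coe_add, mul_add, mul_add, mul_comm]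
    rw [ENNReal.coe_one, mul_one]
    exact add_le_add_right hle _
  have hne : ((C₀ + 1 : ℝ≥0) : ℝ≥0∞) ≠ 0 := by positivity
  rw [smallMassConst, ← hC₀, ENNReal.coe_div (by positivity), ENNReal.div_eq_inv_mul, mul_assoc,
    ← ENNReal.div_eq_inv_mul]
  exact (ENNReal.le_div_iff_mul_le (Or.inl hne) (Or.inl ENNReal.coe_ne_top)).2 hfin

lemma IsDualPair.lpAvg_restrict_mul_inv_le
    (h : IsDualPair (avgMeasure μ Q) p q c w w' A A') (h0 : μ Q ≠ 0) (h1 : μ Q ≠ ∞) :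
    lpAvg (μ.restrict Q) p (fun x => ‖w x * A⁻¹‖ₑ) ≤ c * μ Q ^ (1 / p) := by
  rw [lpAvg_restrict_self_eq h.holder.pos h0 h1, mul_comm]
  gcongr
  exact h.lpAvg_mul_inv_le

lemma IsDualPair.mul_le_lpAvg_restrict
    (h : IsDualPair (avgMeasure μ Q) p q c w w' A A') (h0 : μ Q ≠ 0) (h1 : μ Q ≠ ∞)
    (M : Matrix (Fin d) (Fin d) ℂ) :
    ‖A * M‖ₑ * μ Q ^ (1 / p) ≤ c * lpAvg (μ.restrict Q) p (fun x => ‖w x * M‖ₑ) := by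
  rw [lpAvg_restrict_self_eq h.holder.pos h0 h1, mul_left_comm, mul_comm]
  gcongr
  exact h.A_le M

end AInfty

/-! ### The two-weight John–Nirenberg inequality. -/

section JohnNirenberg

/-- The mean of `B` over `Q`. -/
noncomputable def mean (μ : Measure X) (B : X → Matrix (Fin d) (Fin d) ℂ) (Q : Set X) :
    Matrix (Fin d) (Fin d) ℂ :=
  ∫ y, B y ∂(avgMeasure μ Q)

/-- The constant of the John–Nirenberg inequality. -/
noncomputable def jnConst (p : ℝ) (Λ cU cV : ℝ≥0) : ℝ≥0 :=
  2 * Λ * cV * cU * (1 - smallMassConst p cU ^ (1 / p))⁻¹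

variable {μ : Measure X} {cell : ℕ → X → Set X} {Λ : ℝ≥0} {p q : ℝ} {cU cV : ℝ≥0}
  {v v' u u' B : X → Matrix (Fin d) (Fin d) ℂ} {𝒱 𝒱' 𝒰 𝒰' : Set X → Matrix (Fin d) (Fin d) ℂ}

/-- The fixed-point equation K = K₀ + Kδ^{1/p} that closes the induction; it has a finite solution
because δ < 1. -/
lemma jnConst_eq (hp : 0 < p) : (jnConst p Λ cU cV : ℝ≥0∞) =
    2 * Λ * cV * cU + jnConst p Λ cU cV * (smallMassConst p cU : ℝ≥0∞) ^ (1 / p) := by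
  have hθ : smallMassConst p cU ^ (1 / p) < 1 :=
    NNReal.rpow_lt_one (smallMassConst_lt_one p cU) (by positivity)
  rw [← ENNReal.coe_rpow_of_nonneg _ (by positivity)]
  norm_cast
  unfold jnConst
  set θ := smallMassConst p cU ^ (1 / p)
  have h1 : (1 - θ)⁻¹ = 1 + (1 - θ)⁻¹ * θ := by
    have hne : 1 - θ ≠ 0 := (tsub_pos_of_lt hθ).ne'
    calc (1 - θ)⁻¹ = (1 - θ)⁻¹ * ((1 - θ) + θ) := by rw [tsub_add_cancel_of_le hθ.le, mul_one]
      _ = _ := by rw [mul_add, inv_mul_cancel₀ hne]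
  conv_lhs => rw [h1]
  ring

/-- The John–Nirenberg inequality for the averages of `B` over the cells of generation `N`. -/
theorem lpAvg_cell_truncated_le (hc : IsCellTree μ cell Λ)
    (hV : ∀ k x, IsDualPair (avgMeasure μ (cell k x)) p q cV v v' (𝒱 (cell k x)) (𝒱' (cell k x)))
    (hU : ∀ k x, IsDualPair (avgMeasure μ (cell k x)) p q cU u u' (𝒰 (cell k x)) (𝒰' (cell k x)))
    (hB : ∀ k x, IntegrableOn B (cell k x) μ) {β : ℝ≥0} (hβ : 0 < β)
    (hosc : ∀ k x, ∫⁻ y, ‖𝒱 (cell k x) * (B y - mean μ B (cell k x)) * (𝒰 (cell k x))⁻¹‖ₑ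
      ∂(avgMeasure μ (cell k x)) ≤ β)
    (M : Matrix (Fin d) (Fin d) ℂ) (N i : ℕ) (hi : i ≤ N) (x : X) :
    lpAvg (μ.restrict (cell i x)) p
        (fun z => ‖v z * (mean μ B (cell N z) - mean μ B (cell i x)) * M‖ₑ)
      ≤ jnConst p Λ cU cV * β * lpAvg (μ.restrict (cell i x)) p (fun z => ‖u z * M‖ₑ) := by
  -- Induction on the number of generations left. Both sides keep the same M on every cell, so the
  -- bounds on subcells can be summed directly.
  induction hk : N - i using Nat.strong_induction_on generalizing i x with
  | _ k IH =>
  subst hk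
  have hp := (hV 0 x).holder.pos
  have hp1 := (hV 0 x).holder.lt.le
  set Q := cell i x with hQdef
  have hQ0 : μ Q ≠ 0 := hc.measure_ne_zero i x
  have hQ1 : μ Q ≠ ∞ := hc.measure_ne_top i x
  have hQm : MeasurableSet Q := hc.measurableSet i x
  rcases hi.eq_or_lt with rfl | hiN
  · refine le_trans (le_of_eq ?_) (zero_le)
    have : lpAvg (μ.restrict Q) p (fun z => ‖v z * (mean μ B (cell i z) - mean μ B Q) * M‖ₑ)
        = lpAvg (μ.restrict Q) p (fun _ => 0) := by
      refine lpAvg_congr_ae ((ae_restrict_iff' hQm).2 (Filter.Eventually.of_forall fun z hz => ?_))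
      rw [hc.eq_of_mem _ _ _ hz]
      simp [hQdef]
    rw [this, lpAvg]
    simp [hp]
  set f : X → ℝ≥0∞ := fun y => ‖𝒱 Q * (B y - mean μ B Q) * (𝒰 Q)⁻¹‖ₑ with hf
  have hfQ : ∫⁻ y in Q, f y ∂μ ≤ β * μ Q := by
    have := hosc i x
    rw [lintegral_avgMeasure, ← ENNReal.div_eq_inv_mul] at this
    exact (ENNReal.div_le_iff hQ0 hQ1).1 this
  -- Stop where the average of f exceeds 2β, twice its bound on Q.
  let S : Set X → Prop := fun P => 2 * β * μ P < ∫⁻ y in P, f y ∂μ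
  have hSQ : ¬ S Q := by
    refine not_lt.2 (hfQ.trans ?_)
    rw [mul_assoc, two_mul]
    exact le_self_add
  obtain ⟨τ, hτ, hτQ⟩ := hc.exists_stopping hiN x S hSQ
  have hsub : ∀ z ∈ Q, cell (τ z) z ⊆ Q := fun z hz => by
    have := hc.antitone z (hτQ z hz).1.le
    exact this.trans (hc.eq_of_mem _ _ _ hz).subset
  set E := {z ∈ Q | S (cell (τ z) z)} with hE
  have hEsat : ∀ z ∈ E, cell (τ z) z ⊆ E := fun z hz y hy =>
    ⟨hsub z hz.1 hy, by rw [hτ.cell_eq hc hy]; exact hz.2⟩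
  have hEm : MeasurableSet E := hc.measurableSet_of_saturated hEsat
  have hEQ : E ⊆ Q := fun z hz => hz.1
  have hEsmall : 2 * μ E ≤ μ Q := by
    have h1 : ∫⁻ _ in E, 2 * (β : ℝ≥0∞) ∂μ ≤ ∫⁻ y in E, f y ∂μ := by
      refine hc.setLIntegral_mono_of_cells hτ hEsat fun z hz => ?_
      rw [setLIntegral_const]
      exact hz.2.le
    rw [setLIntegral_const] at h1
    have h2 := (h1.trans (lintegral_mono_set hEQ)).trans hfQ
    rw [mul_comm 2 (β : ℝ≥0∞), mul_assoc] at h2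
    -- The weak-type bound: β is cancelled, which needs β > 0.
    exact (ENNReal.mul_le_mul_iff_right (by positivity) ENNReal.coe_ne_top).1 h2
  set h : X → ℝ≥0∞ := fun z => ‖v z * (mean μ B (cell N z) - mean μ B (cell (τ z) z)) * M‖ₑ
    with hh
  -- The parent of a stopped cell did not satisfy S, so the average of f over the cell is at most Λ
  -- times 2β. This covers also the unselected cells of generation N.
  have hjump : ∀ z ∈ Q,
      ‖𝒱 Q * (mean μ B (cell (τ z) z) - mean μ B Q) * (𝒰 Q)⁻¹‖ₑ ≤ 2 * Λ * β := by
    intro z hz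
    obtain ⟨h1, -, h3, -⟩ := hτQ z hz
    set P := cell (τ z) z with hP
    have hP0 : μ P ≠ 0 := hc.measure_ne_zero _ _
    have hP1 : μ P ≠ ∞ := hc.measure_ne_top _ _
    have := isProbabilityMeasure_avgMeasure hP0 hP1
    refine (enorm_mul_integral_sub_mul_le (integrable_avgMeasure hP0 (hB _ _)) _ _ _).trans ?_
    rw [lintegral_avgMeasure, ← ENNReal.div_eq_inv_mul, ENNReal.div_le_iff hP0 hP1]
    have hsucc : τ z - 1 + 1 = τ z := by omega
    have hle := hc.measure_le (τ z - 1) z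
    have hss := hc.succ_subset (τ z - 1) z
    rw [hsucc] at hle hss
    calc ∫⁻ y in P, f y ∂μ ≤ ∫⁻ y in cell (τ z - 1) z, f y ∂μ := lintegral_mono_set hss
      _ ≤ 2 * β * μ (cell (τ z - 1) z) := not_lt.1 h3
      _ ≤ 2 * β * (Λ * μ P) := by gcongr
      _ = _ := by ring
  have hpt : ∀ z ∈ Q, ‖v z * (mean μ B (cell N z) - mean μ B Q) * M‖ₑ
      ≤ (2 * Λ * β * ‖𝒰 Q * M‖ₑ) * ‖v z * (𝒱 Q)⁻¹‖ₑ + h z := by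
    intro z hz
    -- Telescope through the mean over the stopped cell; on the jump insert 𝒱⁻¹𝒱 and 𝒰⁻¹𝒰 for Q
    -- alone.
    have heq : v z * (mean μ B (cell N z) - mean μ B Q) * M
        = (v z * (𝒱 Q)⁻¹) * ((𝒱 Q * (mean μ B (cell (τ z) z) - mean μ B Q) * (𝒰 Q)⁻¹)
            * (𝒰 Q * M)) + v z * (mean μ B (cell N z) - mean μ B (cell (τ z) z)) * M := by
      simp only [mul_assoc]
      rw [← mul_assoc (𝒱 Q)⁻¹, mul_eq_one_comm.1 (hV i x).inv_A, one_mul,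
        ← mul_assoc (𝒰 Q)⁻¹, mul_eq_one_comm.1 (hU i x).inv_A, one_mul, ← mul_add, ← add_mul,
        add_comm (_ - _) (_ - _), sub_add_sub_cancel]
    rw [heq]
    refine (enorm_add_le _ _).trans (add_le_add ?_ le_rfl)
    calc _ ≤ ‖v z * (𝒱 Q)⁻¹‖ₑ * (‖𝒱 Q * (mean μ B (cell (τ z) z) - mean μ B Q) * (𝒰 Q)⁻¹‖ₑ
              * ‖𝒰 Q * M‖ₑ) :=
          (enorm_mul_le' _ _).trans (by gcongr; exact enorm_mul_le' _ _)
      _ ≤ ‖v z * (𝒱 Q)⁻¹‖ₑ * ((2 * Λ * β) * ‖𝒰 Q * M‖ₑ) := by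
          gcongr
          exact hjump z hz
      _ = _ := by ring
  have hac : μ.restrict Q ≪ avgMeasure μ Q := absolutelyContinuous_avgMeasure hQ1
  have hm1 : AEMeasurable (fun z => ‖v z * (𝒱 Q)⁻¹‖ₑ) (μ.restrict Q) :=
    ((hV i x).aemeasurable_mul _).mono_ac hac
  have hgen : IsCellTree.IsStopping cell fun _ => N := fun _ _ _ => rfl
  have hm2 : AEMeasurable h (μ.restrict Q) :=
    ((((hV i x).meas.mono_ac hac).mul
      ((hc.stronglyMeasurable_stopped hgen (mean μ B)).sub
        (hc.stronglyMeasurable_stopped hτ (mean μ B))).aestronglyMeasurable).mul_const M).enorm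
  -- Off E the stopping generation is N and h vanishes; on each cell of E the induction hypothesis
  -- applies.
  have hhE : ∫⁻ z in Q, h z ^ p ∂μ ≤ ∫⁻ z in E, (jnConst p Λ cU cV * β * ‖u z * M‖ₑ) ^ p ∂μ := by
    have h1 : ∫⁻ z in Q, h z ^ p ∂μ = ∫⁻ z in E, h z ^ p ∂μ := by
      have h2 : ∫⁻ z in Q \ E, h z ^ p ∂μ = 0 := by
        rw [setLIntegral_congr_fun (g := fun _ => 0) (hQm.diff hEm) fun z hz => ?_,
          lintegral_zero]
        have : τ z = N := (hτQ z hz.1).2.2.2 fun hS => hz.2 ⟨hz.1, hS⟩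
        simp [hh, this, hp]
      rw [← union_sdiff_cancel hEQ, lintegral_union (hQm.diff hEm) disjoint_sdiff_right, h2,
        add_zero]
    rw [h1]
    refine hc.setLIntegral_mono_of_cells hτ hEsat fun z hz => ?_
    obtain ⟨h2, h3, -, -⟩ := hτQ z hz.1
    have h4 := ENNReal.rpow_le_rpow (IH (N - τ z) (by omega) (τ z) h3 z rfl) hp.le
    rw [ENNReal.mul_rpow_of_nonneg _ _ hp.le, lpAvg_rpow hp, lpAvg_rpow hp,
      ← lintegral_const_mul' _ _ (by finiteness)] at h4
    simp only [← ENNReal.mul_rpow_of_nonneg _ _ hp.le] at h4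
    refine le_trans (le_of_eq ?_) h4
    refine setLIntegral_congr_fun (hc.measurableSet _ _) fun y hy => ?_
    simp only [hh, hτ.cell_eq hc hy]
  have hhlp : lpAvg (μ.restrict Q) p h ≤ jnConst p Λ cU cV * β *
      ((smallMassConst p cU : ℝ≥0∞) ^ (1 / p) *
        lpAvg (μ.restrict Q) p (fun z => ‖u z * M‖ₑ)) := by
    -- The A_∞ property of the weight u returns from E to Q with the gain δ.
    have h1 := (hU i x).setLIntegral_le_smallMassConst hQ0 hQ1 hQm hEm hEQ hEsmall M
    simp only [ENNReal.mul_rpow_of_nonneg _ _ hp.le] at hhE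
    rw [lintegral_const_mul' _ _ (by finiteness)] at hhE
    have h2 := ENNReal.rpow_le_rpow (hhE.trans (mul_le_mul_right h1 _))
      (by positivity : 0 ≤ 1 / p)
    refine h2.trans_eq ?_
    rw [ENNReal.mul_rpow_of_nonneg _ _ (by positivity),
      ENNReal.mul_rpow_of_nonneg _ _ (by positivity),
      ENNReal.mul_rpow_of_nonneg _ _ (by positivity), ← ENNReal.rpow_mul, ← ENNReal.rpow_mul,
      mul_one_div_cancel hp.ne', ENNReal.rpow_one, ENNReal.rpow_one]
    rfl
  calc _ ≤ lpAvg (μ.restrict Q) p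
          (fun z => (2 * Λ * β * ‖𝒰 Q * M‖ₑ) * ‖v z * (𝒱 Q)⁻¹‖ₑ + h z) :=
        lpAvg_mono_ae hp ((ae_restrict_iff' hQm).2 (Filter.Eventually.of_forall hpt))
    _ ≤ (2 * Λ * β * ‖𝒰 Q * M‖ₑ) * lpAvg (μ.restrict Q) p (fun z => ‖v z * (𝒱 Q)⁻¹‖ₑ)
          + lpAvg (μ.restrict Q) p h := by
        refine (lpAvg_add_le hp1 (hm1.const_mul _) hm2).trans ?_
        rw [lpAvg_const_mul hp hm1]
    _ ≤ (2 * Λ * β * ‖𝒰 Q * M‖ₑ) * (cV * μ Q ^ (1 / p)) + jnConst p Λ cU cV * β *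
          ((smallMassConst p cU : ℝ≥0∞) ^ (1 / p) *
            lpAvg (μ.restrict Q) p (fun z => ‖u z * M‖ₑ)) := by
        gcongr
        exact (hV i x).lpAvg_restrict_mul_inv_le hQ0 hQ1
    _ = (2 * Λ * β * cV) * (‖𝒰 Q * M‖ₑ * μ Q ^ (1 / p)) + jnConst p Λ cU cV * β *
          ((smallMassConst p cU : ℝ≥0∞) ^ (1 / p) *
            lpAvg (μ.restrict Q) p (fun z => ‖u z * M‖ₑ)) := by ring
    _ ≤ (2 * Λ * β * cV) * (cU * lpAvg (μ.restrict Q) p (fun z => ‖u z * M‖ₑ))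
          + jnConst p Λ cU cV * β * ((smallMassConst p cU : ℝ≥0∞) ^ (1 / p) *
            lpAvg (μ.restrict Q) p (fun z => ‖u z * M‖ₑ)) := by
        refine add_le_add_left ?_ _
        exact mul_le_mul_right ((hU i x).mul_le_lpAvg_restrict hQ0 hQ1 M) _
    _ = (2 * Λ * cV * cU + jnConst p Λ cU cV * (smallMassConst p cU : ℝ≥0∞) ^ (1 / p)) * β
          * lpAvg (μ.restrict Q) p (fun z => ‖u z * M‖ₑ) := by ring
    _ = _ := by rw [← jnConst_eq hp]

/-- The John–Nirenberg inequality with two matrix weights on a tree of cells that differentiates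
`B`. -/
theorem lpAvg_sub_mean_le_of_cellTree (hc : IsCellTree μ cell Λ)
    (hV : ∀ k x, IsDualPair (avgMeasure μ (cell k x)) p q cV v v' (𝒱 (cell k x)) (𝒱' (cell k x)))
    (hU : ∀ k x, IsDualPair (avgMeasure μ (cell k x)) p q cU u u' (𝒰 (cell k x)) (𝒰' (cell k x)))
    (hB : ∀ k x, IntegrableOn B (cell k x) μ)
    (hlim : ∀ᵐ z ∂μ, Filter.Tendsto (fun N => mean μ B (cell N z)) Filter.atTop (nhds (B z)))
    {β : ℝ≥0} (hβ : 0 < β)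
    (hosc : ∀ k x, ∫⁻ y, ‖𝒱 (cell k x) * (B y - mean μ B (cell k x)) * (𝒰 (cell k x))⁻¹‖ₑ
      ∂(avgMeasure μ (cell k x)) ≤ β) (x : X) :
    lpAvg (avgMeasure μ (cell 0 x)) p
        (fun z => ‖v z * (B z - mean μ B (cell 0 x)) * (𝒰 (cell 0 x))⁻¹‖ₑ)
      ≤ jnConst p Λ cU cV * β * cU := by
  have hp := (hV 0 x).holder.pos
  set Q := cell 0 x with hQ
  have hQ0 : μ Q ≠ 0 := hc.measure_ne_zero 0 x
  have hQ1 : μ Q ≠ ∞ := hc.measure_ne_top 0 x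
  have hbound : ∀ N, ∫⁻ z, ‖v z * (mean μ B (cell N z) - mean μ B Q) * (𝒰 Q)⁻¹‖ₑ ^ p
      ∂(avgMeasure μ Q) ≤ (jnConst p Λ cU cV * β * cU) ^ p := by
    intro N
    -- The choice M = 𝒰⁻¹ makes the right-hand norm at most a constant by the reducing property.
    have h1 := lpAvg_cell_truncated_le hc hV hU hB hβ hosc (𝒰 Q)⁻¹ N 0 (Nat.zero_le _) x
    rw [← hQ, lpAvg_restrict_self_eq hp hQ0 hQ1, lpAvg_restrict_self_eq hp hQ0 hQ1,
      mul_left_comm, ENNReal.mul_le_mul_iff_right] at h1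
    · have h2 := ENNReal.rpow_le_rpow (h1.trans (mul_le_mul_right (hU 0 x).lpAvg_mul_inv_le _)) hp.le
      rwa [lpAvg_rpow hp] at h2
    · exact (ENNReal.rpow_pos (pos_iff_ne_zero.2 hQ0) hQ1).ne'
    · exact ENNReal.rpow_ne_top_of_nonneg (by positivity) hQ1
  have hac : avgMeasure μ Q ≪ μ :=
    avgMeasure_absolutelyContinuous.trans Measure.restrict_le_self.absolutelyContinuous
  -- The bound is uniform in N, and the averages over the cells tend to B almost everywhere.
  have hfatou : ∫⁻ z, ‖v z * (B z - mean μ B Q) * (𝒰 Q)⁻¹‖ₑ ^ p ∂(avgMeasure μ Q)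
      ≤ (jnConst p Λ cU cV * β * cU) ^ p := by
    have hgen : ∀ N, IsCellTree.IsStopping cell fun _ => N := fun _ _ _ _ => rfl
    calc _ = ∫⁻ z, Filter.liminf (fun N => ‖v z * (mean μ B (cell N z) - mean μ B Q)
            * (𝒰 Q)⁻¹‖ₑ ^ p) Filter.atTop ∂(avgMeasure μ Q) := by
          refine lintegral_congr_ae ?_
          filter_upwards [hac.ae_le hlim] with z hz
          refine (Filter.Tendsto.liminf_eq ?_).symm
          refine (ENNReal.continuous_rpow_const.tendsto _).comp ((continuous_enorm.tendsto _).comp ?_)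
          exact ((hz.sub_const _).const_mul _).mul_const _
      _ ≤ Filter.liminf (fun N => ∫⁻ z, ‖v z * (mean μ B (cell N z) - mean μ B Q)
            * (𝒰 Q)⁻¹‖ₑ ^ p ∂(avgMeasure μ Q)) Filter.atTop := by
          refine lintegral_liminf_le' fun N => ?_
          exact ((((hV 0 x).meas.mul ((hc.stronglyMeasurable_stopped (hgen N) (mean μ B)).sub
            stronglyMeasurable_const).aestronglyMeasurable).mul_const _).enorm).pow_const p
      _ ≤ _ := by
          refine (Filter.liminf_le_liminf (Filter.Eventually.of_forall hbound)).trans ?_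
          rw [Filter.liminf_const]
  have := ENNReal.rpow_le_rpow hfatou (by positivity : 0 ≤ 1 / p)
  rwa [← ENNReal.rpow_mul, mul_one_div_cancel hp.ne', ENNReal.rpow_one] at this

end JohnNirenberg

end DualPairs

/-! ### Lebesgue differentiation along sets of bounded eccentricity. -/

section Differentiation

variable {X : Type*} [PseudoMetricSpace X] [MeasurableSpace X] [SecondCountableTopology X]
  [BorelSpace X] {μ : Measure X} [IsLocallyFiniteMeasure μ] [IsUnifLocDoublingMeasure μ] {d : ℕ}

/-- Lebesgue differentiation along sets that fill a fixed proportion of shrinking balls. -/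
lemma ae_tendsto_mean {B : X → Matrix (Fin d) (Fin d) ℂ} (hB : LocallyIntegrable B μ) :
    -- One null set serves all sequences, so Q may depend on z.
    ∀ᵐ z ∂μ, ∀ (Q : ℕ → Set X) (r : ℕ → ℝ) (C : ℝ≥0),
      Filter.Tendsto r Filter.atTop (nhdsWithin 0 (Ioi 0)) →
      (∀ N, Q N ⊆ Metric.closedBall z (r N)) → (∀ N, IntegrableOn B (Q N) μ) →
      (∀ N, μ (Metric.closedBall z (r N)) ≤ C * μ (Q N)) →
      (∀ N, μ (Q N) ≠ 0) → (∀ N, μ (Q N) ≠ ∞) →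
      Filter.Tendsto (fun N => mean μ B (Q N)) Filter.atTop (nhds (B z)) := by
  filter_upwards [(IsUnifLocDoublingMeasure.vitaliFamily μ 1).ae_tendsto_lintegral_enorm_sub_div hB]
    with z hz Q r C hr hQr hBQ hC h0 h1
  have hpos : ∀ᶠ N in Filter.atTop, 0 < r N := hr self_mem_nhdsWithin
  have hlim := hz.comp (IsUnifLocDoublingMeasure.tendsto_closedBall_filterAt μ (K := 1)
    (fun _ => z) r hr (by
      filter_upwards [hpos] with N hN
      exact Metric.mem_closedBall_self (by linarith)))
  have hlim' := ENNReal.Tendsto.const_mul (a := (C : ℝ≥0∞)) hlim (Or.inr ENNReal.coe_ne_top)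
  rw [mul_zero] at hlim'
  rw [tendsto_iff_edist_tendsto_0]
  refine tendsto_of_tendsto_of_tendsto_of_le_of_le tendsto_const_nhds hlim' (fun _ => zero_le)
    fun N => ?_
  have := isProbabilityMeasure_avgMeasure (h0 N) (h1 N)
  have hint := integrable_avgMeasure (h0 N) (hBQ N)
  simp only [Function.comp_apply]
  have hball0 : μ (Metric.closedBall z (r N)) ≠ 0 := fun h =>
    h0 N (measure_mono_null (hQr N) h)
  have hball1 : μ (Metric.closedBall z (r N)) ≠ ∞ :=
    ne_top_of_le_ne_top (ENNReal.mul_ne_top ENNReal.coe_ne_top (h1 N)) (hC N)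
  calc edist (mean μ B (Q N)) (B z) = ‖∫ y, (B y - B z) ∂(avgMeasure μ (Q N))‖ₑ := by
        rw [edist_eq_enorm_sub, integral_sub hint (integrable_const _)]
        simp [mean]
    _ ≤ (μ (Q N))⁻¹ * ∫⁻ y in Q N, ‖B y - B z‖ₑ ∂μ := by
        rw [← lintegral_avgMeasure]
        exact enorm_integral_le_lintegral_enorm _
    _ ≤ (C * (μ (Metric.closedBall z (r N)))⁻¹)
          * ∫⁻ y in Metric.closedBall z (r N), ‖B y - B z‖ₑ ∂μ := by
        refine mul_le_mul' ?_ (lintegral_mono_set (hQr N))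
        rw [← ENNReal.div_eq_inv_mul.trans (mul_comm _ _),
          ENNReal.le_div_iff_mul_le (Or.inl hball0) (Or.inl hball1), mul_comm,
          ← ENNReal.div_eq_inv_mul.trans (mul_comm _ _), ENNReal.div_le_iff (h0 N) (h1 N)]
        exact hC N
    _ = _ := by rw [ENNReal.div_eq_inv_mul, mul_assoc]

end Differentiation

/-! ### Cells of a one-dimensional dyadic grid. -/

section RealGrid

/-- `cell k x` is the interval of generation `k` that contains `x`, in a dyadic grid of `ℝ`. -/
structure IsRealCells (cell : ℤ → ℝ → Set ℝ) : Prop where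
  mem : ∀ k x, x ∈ cell k x
  eq_of_mem : ∀ k x y, y ∈ cell k x → cell k y = cell k x
  succ_subset : ∀ k x, cell (k + 1) x ⊆ cell k x
  eq_Ico : ∀ k x, ∃ a, cell k x = Ico a (a + (2 : ℝ) ^ (-k))

/-- The last clause recovers the generation of an interval from its length, since the sides of a
cube are constrained by their lengths only. -/
lemma IsDyadicGridReal.exists_cells {D : Set (Set ℝ)} (hD : IsDyadicGridReal D) :
    ∃ cell : ℤ → ℝ → Set ℝ, IsRealCells cell ∧ (∀ k x, cell k x ∈ D) ∧
      ∀ I ∈ D, ∀ k : ℤ, volume I = ENNReal.ofReal ((2 : ℝ) ^ (-k)) → ∀ x ∈ I, cell k x = I := by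
  obtain ⟨G, rfl, hpart, hIco, hsplit⟩ := hD
  choose cell hcell huniq using fun k x => (hpart k).2 x
  have heq : ∀ k x, ∀ I ∈ G k, x ∈ I → cell k x = I := fun k x I hI hx =>
    (huniq k x I ⟨hI, hx⟩).symm
  refine ⟨cell, ⟨fun k x => (hcell k x).2, fun k x y hy => heq k y _ (hcell k x).1 hy, ?_,
    fun k x => hIco k _ (hcell k x).1⟩, fun k x => mem_iUnion.2 ⟨k, (hcell k x).1⟩, ?_⟩
  · intro k x
    obtain ⟨I₁, hI₁, I₂, hI₂, -, h⟩ := hsplit k _ (hcell k x).1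
    have hx := (hcell k x).2
    rw [h] at hx ⊢
    rcases hx with hx | hx
    · rw [heq _ _ _ hI₁ hx]
      exact subset_union_left
    · rw [heq _ _ _ hI₂ hx]
      exact subset_union_right
  · intro I hI k hvol x hx
    obtain ⟨j, hj⟩ := mem_iUnion.1 hI
    obtain ⟨a, ha⟩ := hIco j I hj
    have hjk : j = k := by
      rw [ha, Real.volume_Ico, add_sub_cancel_left,
        ENNReal.ofReal_eq_ofReal_iff (by positivity) (by positivity)] at hvol
      have := zpow_right_injective₀ (a := (2 : ℝ)) (by norm_num) (by norm_num) hvol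
      omega
    subst hjk
    exact heq _ _ _ hj hx

variable {cell : ℤ → ℝ → Set ℝ}

lemma IsRealCells.measurableSet (h : IsRealCells cell) (k : ℤ) (x : ℝ) :
    MeasurableSet (cell k x) := by
  obtain ⟨a, ha⟩ := h.eq_Ico k x
  rw [ha]
  exact measurableSet_Ico

lemma IsRealCells.volume_eq (h : IsRealCells cell) (k : ℤ) (x : ℝ) :
    volume (cell k x) = ENNReal.ofReal ((2 : ℝ) ^ (-k)) := by
  obtain ⟨a, ha⟩ := h.eq_Ico k x
  rw [ha, Real.volume_Ico, add_sub_cancel_left]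

lemma IsRealCells.interior_nonempty (h : IsRealCells cell) (k : ℤ) (x : ℝ) :
    (interior (cell k x)).Nonempty := by
  obtain ⟨a, ha⟩ := h.eq_Ico k x
  rw [ha, interior_Ico, nonempty_Ioo]
  have : (0 : ℝ) < 2 ^ (-k) := by positivity
  linarith

lemma IsRealCells.dist_le (h : IsRealCells cell) {k : ℤ} {x y : ℝ} (hy : y ∈ cell k x) :
    dist y x ≤ (2 : ℝ) ^ (-k) := by
  obtain ⟨a, ha⟩ := h.eq_Ico k x
  have hx := h.mem k x
  rw [ha] at hx hy
  rw [Real.dist_eq, abs_le]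
  constructor <;> linarith [hx.1, hx.2, hy.1, hy.2]

end RealGrid

/-! ### Cubes, rectangles and the tree below a rectangle. -/

section CubeCells

variable {n m : ℕ} {c₁ : Fin n → ℤ → ℝ → Set ℝ} {c₂ : Fin m → ℤ → ℝ → Set ℝ}

/-- The cube of generation `k` that contains `x`. -/
def cubeCell (c : Fin n → ℤ → ℝ → Set ℝ) (k : ℤ) (x : Fin n → ℝ) : Set (Fin n → ℝ) :=
  univ.pi fun i => c i k (x i)

lemma cubeCell_eq_of_mem (h : ∀ i, IsRealCells (c₁ i)) {k : ℤ} {x y : Fin n → ℝ}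
    (hy : y ∈ cubeCell c₁ k x) : cubeCell c₁ k y = cubeCell c₁ k x := by
  unfold cubeCell
  congr 1
  funext i
  exact (h i).eq_of_mem _ _ _ (hy i (mem_univ i))

lemma volume_cubeCell (h : ∀ i, IsRealCells (c₁ i)) (k : ℤ) (x : Fin n → ℝ) :
    volume (cubeCell c₁ k x) = ENNReal.ofReal ((2 : ℝ) ^ (-k)) ^ n := by
  simp [cubeCell, volume_pi_pi, (h _).volume_eq]

lemma cubeCell_subset_closedBall (h : ∀ i, IsRealCells (c₁ i)) (k : ℤ) (x : Fin n → ℝ) :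
    cubeCell c₁ k x ⊆ Metric.closedBall x ((2 : ℝ) ^ (-k)) := by
  intro y hy
  rw [Metric.mem_closedBall, dist_pi_le_iff (by positivity)]
  exact fun i => (h i).dist_le (hy i (mem_univ i))

lemma interior_cubeCell_nonempty (h : ∀ i, IsRealCells (c₁ i)) (k : ℤ) (x : Fin n → ℝ) :
    (interior (cubeCell c₁ k x)).Nonempty := by
  rw [cubeCell, interior_pi_set finite_univ, univ_pi_nonempty_iff]
  exact fun i => (h i).interior_nonempty _ _

/-- The rectangles of the generations `k₁ + N` and `k₂ + N` in the two factors. -/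
def boxCell (c₁ : Fin n → ℤ → ℝ → Set ℝ) (c₂ : Fin m → ℤ → ℝ → Set ℝ) (k₁ k₂ : ℤ) (N : ℕ)
    (x : (Fin n → ℝ) × (Fin m → ℝ)) : Set ((Fin n → ℝ) × (Fin m → ℝ)) :=
  cubeCell c₁ (k₁ + N) x.1 ×ˢ cubeCell c₂ (k₂ + N) x.2

lemma volume_boxCell (h₁ : ∀ i, IsRealCells (c₁ i)) (h₂ : ∀ i, IsRealCells (c₂ i)) (k₁ k₂ : ℤ)
    (N : ℕ) (x : (Fin n → ℝ) × (Fin m → ℝ)) :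
    volume (boxCell c₁ c₂ k₁ k₂ N x) = ENNReal.ofReal ((2 : ℝ) ^ (-(k₁ + N))) ^ n *
      ENNReal.ofReal ((2 : ℝ) ^ (-(k₂ + N))) ^ m := by
  rw [boxCell, Measure.volume_eq_prod, Measure.prod_prod, volume_cubeCell h₁, volume_cubeCell h₂]

lemma ofReal_two_zpow_succ (k : ℤ) (N : ℕ) :
    ENNReal.ofReal ((2 : ℝ) ^ (-(k + N))) = 2 * ENNReal.ofReal ((2 : ℝ) ^ (-(k + (N + 1 : ℕ)))) := by
  rw [← ENNReal.ofReal_ofNat 2, ← ENNReal.ofReal_mul (by norm_num), ← zpow_one_add₀ (by norm_num)]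
  congr 2
  push_cast
  ring

/-- Both factors are halved at every step, so a parent has exactly 2^{n+m} times the measure of a
child, whatever k₁ and k₂. -/
lemma isCellTree_boxCell (h₁ : ∀ i, IsRealCells (c₁ i)) (h₂ : ∀ i, IsRealCells (c₂ i))
    (k₁ k₂ : ℤ) : IsCellTree volume (boxCell c₁ c₂ k₁ k₂) (2 ^ n * 2 ^ m) := by
  have heq : ∀ k x y, y ∈ boxCell c₁ c₂ k₁ k₂ k x → boxCell c₁ c₂ k₁ k₂ k y
      = boxCell c₁ c₂ k₁ k₂ k x := fun k x y hy => by
    unfold boxCell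
    rw [cubeCell_eq_of_mem h₁ hy.1, cubeCell_eq_of_mem h₂ hy.2]
  refine ⟨fun k x => ⟨fun i _ => (h₁ i).mem _ _, fun i _ => (h₂ i).mem _ _⟩, heq, ?_, ?_, ?_, ?_, ?_,
    ?_⟩
  · intro k x
    have hsub : ∀ j : ℤ, j + ((k + 1 : ℕ) : ℤ) = j + k + 1 := fun j => by push_cast; ring
    refine prod_mono (pi_mono fun i _ => ?_) (pi_mono fun i _ => ?_)
    · rw [hsub]
      exact (h₁ i).succ_subset _ _
    · rw [hsub]
      exact (h₂ i).succ_subset _ _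
  · intro k x
    exact (MeasurableSet.univ_pi fun i => (h₁ i).measurableSet _ _).prod
      (MeasurableSet.univ_pi fun i => (h₂ i).measurableSet _ _)
  · intro k
    -- Each cell has nonempty interior, so it contains a point of a dense sequence.
    refine (countable_range fun j : ℕ =>
      boxCell c₁ c₂ k₁ k₂ k (TopologicalSpace.denseSeq _ j)).mono ?_
    rintro _ ⟨x, rfl⟩
    have hne : (interior (boxCell c₁ c₂ k₁ k₂ k x)).Nonempty := by
      rw [boxCell, interior_prod_eq]
      exact (interior_cubeCell_nonempty h₁ _ _).prod (interior_cubeCell_nonempty h₂ _ _)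
    obtain ⟨j, hj⟩ := (TopologicalSpace.denseRange_denseSeq _).exists_mem_open isOpen_interior hne
    exact ⟨j, heq _ _ _ (interior_subset hj)⟩
  · intro k x
    rw [volume_boxCell h₁ h₂]
    positivity
  · intro k x
    rw [volume_boxCell h₁ h₂]
    finiteness
  · intro k x
    rw [volume_boxCell h₁ h₂, volume_boxCell h₁ h₂, ofReal_two_zpow_succ k₁ k,
      ofReal_two_zpow_succ k₂ k]
    apply le_of_eq
    push_cast
    ring

lemma ae_tendsto_mean_boxCell {d : ℕ} {B : (Fin n → ℝ) × (Fin m → ℝ) → Matrix (Fin d) (Fin d) ℂ}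
    (hB : LocallyIntegrable B volume)
    (h₁ : ∀ i, IsRealCells (c₁ i)) (h₂ : ∀ i, IsRealCells (c₂ i)) (k₁ k₂ : ℤ) :
    (∀ N x, IntegrableOn B (boxCell c₁ c₂ k₁ k₂ N x) volume) ∧
    ∀ᵐ z, Filter.Tendsto (fun N => mean volume B (boxCell c₁ c₂ k₁ k₂ N z)) Filter.atTop
      (nhds (B z)) := by
  set ρ : ℝ := max (2 ^ (-k₁)) (2 ^ (-k₂)) with hρ
  have hρ0 : 0 < ρ := lt_max_of_lt_left (by positivity)
  set r : ℕ → ℝ := fun N => ρ * (1 / 2) ^ N with hr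
  have hz : ∀ (k : ℤ) (N : ℕ), (2 : ℝ) ^ (-(k + N)) = 2 ^ (-k) * (1 / 2) ^ N := fun k N => by
    rw [neg_add, zpow_add₀ (by norm_num), zpow_neg _ (N : ℤ), zpow_natCast]
    simp
  have hsub : ∀ N z, boxCell c₁ c₂ k₁ k₂ N z ⊆ Metric.closedBall z (r N) := by
    intro N z
    rw [← Prod.mk.eta (p := z), ← closedBall_prod_same]
    refine prod_mono ((cubeCell_subset_closedBall h₁ _ _).trans
      (Metric.closedBall_subset_closedBall ?_)) ((cubeCell_subset_closedBall h₂ _ _).trans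
      (Metric.closedBall_subset_closedBall ?_))
    · rw [hz]
      exact mul_le_mul_of_nonneg_right (le_max_left _ _) (by positivity)
    · rw [hz]
      exact mul_le_mul_of_nonneg_right (le_max_right _ _) (by positivity)
  have hint : ∀ N x, IntegrableOn B (boxCell c₁ c₂ k₁ k₂ N x) volume := fun N x =>
    (hB.integrableOn_isCompact (isCompact_closedBall x (r N))).mono_set (hsub N x)
  refine ⟨hint, ?_⟩
  have htree := isCellTree_boxCell h₁ h₂ k₁ k₂
  filter_upwards [ae_tendsto_mean hB] with z hlim
  -- Ratio of the volume of the ball, of side 2r, to that of the rectangle. It depends on the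
  -- eccentricity through k₁ - k₂, which is harmless: only the existence of the limit is kept.
  refine hlim _ r ((2 * ρ / 2 ^ (-k₁)).toNNReal ^ n * (2 * ρ / 2 ^ (-k₂)).toNNReal ^ m) ?_
    (fun N => hsub N z) (fun N => hint N z) ?_ (fun N => htree.measure_ne_zero N z)
    (fun N => htree.measure_ne_top N z)
  · refine tendsto_nhdsWithin_iff.2 ⟨?_, Filter.Eventually.of_forall fun N => ?_⟩
    · have := (tendsto_pow_atTop_nhds_zero_of_lt_one (r := (1 / 2 : ℝ)) (by norm_num)
        (by norm_num)).const_mul ρ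
      rwa [mul_zero] at this
    · exact mul_pos hρ0 (by positivity)
  · intro N
    have hfac : ∀ k : ℤ, ENNReal.ofReal (2 * r N)
        = ENNReal.ofReal (2 * ρ / 2 ^ (-k)) * ENNReal.ofReal (2 ^ (-(k + N))) := by
      intro k
      rw [← ENNReal.ofReal_mul (by positivity), hz, hr]
      congr 1
      field_simp
    have hr0 : 0 ≤ r N := by positivity
    rw [volume_boxCell h₁ h₂, ← Prod.mk.eta (p := z), ← closedBall_prod_same,
      Measure.volume_eq_prod, Measure.prod_prod, Real.volume_pi_closedBall _ hr0,
      Real.volume_pi_closedBall _ hr0, Fintype.card_fin, Fintype.card_fin,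
      ENNReal.ofReal_pow (by positivity), ENNReal.ofReal_pow (by positivity)]
    refine (congrArg₂ (· * ·) (congrArg (· ^ n) (hfac k₁))
      (congrArg (· ^ m) (hfac k₂))).le.trans (le_of_eq ?_)
    push_cast
    simp only [ENNReal.ofReal]
    ring

/-- Below every rectangle of a product dyadic grid there is a tree of rectangles of the grid that
differentiates locally integrable functions. -/
theorem exists_cellTree {D₁ : Set (Set (Fin n → ℝ))} {D₂ : Set (Set (Fin m → ℝ))}
    (hD₁ : IsDyadicGrid D₁) (hD₂ : IsDyadicGrid D₂)
    {R : Set ((Fin n → ℝ) × (Fin m → ℝ))} (hR : R ∈ productGrid D₁ D₂) :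
    ∃ cell, IsCellTree volume cell (2 ^ n * 2 ^ m) ∧ (∀ N x, cell N x ∈ productGrid D₁ D₂) ∧
      (∃ x, cell 0 x = R) ∧
      ∀ {d : ℕ} (B : (Fin n → ℝ) × (Fin m → ℝ) → Matrix (Fin d) (Fin d) ℂ),
        LocallyIntegrable B volume → (∀ N x, IntegrableOn B (cell N x) volume) ∧
        ∀ᵐ z, Filter.Tendsto (fun N => mean volume B (cell N z)) Filter.atTop (nhds (B z)) := by
  obtain ⟨R₁, hR₁, R₂, hR₂, rfl⟩ := hR
  have key : ∀ {l : ℕ} {D : Set (Set (Fin l → ℝ))}, IsDyadicGrid D → ∀ P ∈ D,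
      ∃ (c : Fin l → ℤ → ℝ → Set ℝ) (k : ℤ) (x : Fin l → ℝ), (∀ i, IsRealCells (c i)) ∧
        (∀ j x, cubeCell c j x ∈ D) ∧ cubeCell c k x = P := by
    rintro l D ⟨G, hG, rfl⟩ P hP
    choose c hc hcG hceq using fun i => (hG i).exists_cells
    obtain ⟨k, I, hI, rfl⟩ := mem_iUnion.1 hP
    have hne : ∀ i, (I i).Nonempty := fun i => by
      rw [nonempty_iff_ne_empty]
      intro h
      have := (hI i).2
      rw [h, measure_empty, eq_comm, ENNReal.ofReal_eq_zero] at this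
      exact absurd this (not_le.2 (by positivity))
    choose x hx using hne
    refine ⟨c, k, x, hc, fun j y => mem_iUnion.2 ⟨j, fun i => c i j (y i),
      fun i => ⟨hcG i _ _, (hc i).volume_eq _ _⟩, rfl⟩, ?_⟩
    unfold cubeCell
    congr 1
    funext i
    exact hceq i _ (hI i).1 k (hI i).2 _ (hx i)
  obtain ⟨c₁, k₁, x₁, h₁, hm₁, he₁⟩ := key hD₁ R₁ hR₁
  obtain ⟨c₂, k₂, x₂, h₂, hm₂, he₂⟩ := key hD₂ R₂ hR₂
  refine ⟨boxCell c₁ c₂ k₁ k₂, isCellTree_boxCell h₁ h₂ k₁ k₂,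
    fun N x => ⟨_, hm₁ _ _, _, hm₂ _ _, rfl⟩, ⟨(x₁, x₂), ?_⟩,
    fun B hB => ae_tendsto_mean_boxCell hB h₁ h₂ k₁ k₂⟩
  simp [boxCell, he₁, he₂]

end CubeCells

/-! ### From vectors to matrices, and the product AA'. -/

section Reduction

variable {X : Type*} [MeasurableSpace X] {d : ℕ} {ν : Measure X} {p q : ℝ}
  {w w' : X → Matrix (Fin d) (Fin d) ℂ} {A A' : Matrix (Fin d) (Fin d) ℂ}

/-- The loss in passing from vectors to matrices in the definition of a reducing operator. -/
noncomputable def reductionConst (d : ℕ) : ℝ≥0 := d * (NNReal.sqrt d + 1)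

lemma toEuclideanCLM_mul_apply (M N : Matrix (Fin d) (Fin d) ℂ) (e : EuclideanSpace ℂ (Fin d)) :
    Matrix.toEuclideanCLM (𝕜 := ℂ) (M * N) e
      = Matrix.toEuclideanCLM (𝕜 := ℂ) M (Matrix.toEuclideanCLM (𝕜 := ℂ) N e) := by
  rw [map_mul]
  rfl

lemma continuous_toEuclideanCLM_apply (e : EuclideanSpace ℂ (Fin d)) :
    Continuous fun M : Matrix (Fin d) (Fin d) ℂ => Matrix.toEuclideanCLM (𝕜 := ℂ) M e :=
  LinearMap.continuous_of_finiteDimensional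
    ({ toFun := fun M => Matrix.toEuclideanCLM (𝕜 := ℂ) M e
       map_add' := fun M N => by rw [map_add]; rfl
       map_smul' := fun a M => by rw [map_smul]; rfl } :
      Matrix (Fin d) (Fin d) ℂ →ₗ[ℂ] EuclideanSpace ℂ (Fin d))

lemma lpAvg_mul_le_of_reducing (hp : 1 ≤ p) (hw : AEStronglyMeasurable w ν)
    (h : ∀ e : EuclideanSpace ℂ (Fin d),
      lpAvg ν p (fun x => ‖Matrix.toEuclideanCLM (𝕜 := ℂ) (w x) e‖ₑ)
        ≤ ‖Matrix.toEuclideanCLM (𝕜 := ℂ) A e‖ₑ) (M : Matrix (Fin d) (Fin d) ℂ) :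
    lpAvg ν p (fun x => ‖w x * M‖ₑ) ≤ reductionConst d * ‖A * M‖ₑ := by
  have hp0 : 0 < p := by linarith
  calc _ ≤ lpAvg ν p (fun x => ∑ j,
          ‖Matrix.toEuclideanCLM (𝕜 := ℂ) (w x * M) (EuclideanSpace.single j 1)‖ₑ) :=
        lpAvg_mono hp0 fun x => enorm_le_sum_columns _
    _ ≤ ∑ j, lpAvg ν p (fun x =>
          ‖Matrix.toEuclideanCLM (𝕜 := ℂ) (w x * M) (EuclideanSpace.single j 1)‖ₑ) :=
        lpAvg_sum_le _ hp fun j =>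
          ((continuous_toEuclideanCLM_apply _).comp_aestronglyMeasurable (hw.mul_const M)).enorm
    _ ≤ ∑ _j : Fin d, ‖A * M‖ₑ := by
        refine Finset.sum_le_sum fun j _ => ?_
        simp only [toEuclideanCLM_mul_apply]
        refine (h _).trans ?_
        rw [← toEuclideanCLM_mul_apply]
        exact enorm_toEuclideanCLM_single_le _ _
    _ = d * ‖A * M‖ₑ := by simp
    _ ≤ _ := by
        gcongr
        unfold reductionConst
        push_cast
        exact le_mul_of_one_le_right' le_add_self

lemma enorm_mul_le_of_reducing (hp : 0 < p)
    (h : ∀ e : EuclideanSpace ℂ (Fin d), ‖Matrix.toEuclideanCLM (𝕜 := ℂ) A e‖ₑ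
      ≤ ENNReal.ofReal (Real.sqrt d) *
        lpAvg ν p (fun x => ‖Matrix.toEuclideanCLM (𝕜 := ℂ) (w x) e‖ₑ))
    (M : Matrix (Fin d) (Fin d) ℂ) :
    ‖A * M‖ₑ ≤ reductionConst d * lpAvg ν p (fun x => ‖w x * M‖ₑ) := by
  calc _ ≤ ∑ j, ‖Matrix.toEuclideanCLM (𝕜 := ℂ) (A * M) (EuclideanSpace.single j 1)‖ₑ :=
        enorm_le_sum_columns _
    _ ≤ ∑ _j : Fin d, ENNReal.ofReal (Real.sqrt d) * lpAvg ν p (fun x => ‖w x * M‖ₑ) := by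
        refine Finset.sum_le_sum fun j _ => ?_
        rw [toEuclideanCLM_mul_apply]
        refine (h _).trans ?_
        gcongr
        refine lpAvg_mono hp fun x => ?_
        rw [← toEuclideanCLM_mul_apply]
        exact enorm_toEuclideanCLM_single_le _ _
    _ = d * ENNReal.ofReal (Real.sqrt d) * lpAvg ν p (fun x => ‖w x * M‖ₑ) := by
        simp [mul_assoc]
    _ ≤ _ := by
        gcongr
        unfold reductionConst
        have : ENNReal.ofReal (Real.sqrt d) = NNReal.sqrt d := by
          rw [← ENNReal.ofReal_coe_nnreal, Real.coe_sqrt, NNReal.coe_natCast]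
        rw [this]
        push_cast
        gcongr
        exact le_self_add

/-- The constant in the comparison of the reducing operators of a weight and of its dual. -/
noncomputable def apConst (d : ℕ) (p : ℝ) (a : ℝ≥0∞) : ℝ≥0 :=
  reductionConst d + reductionConst d ^ 2 * a.toNNReal ^ (1 / p)

/-- Replace A by the average of w and then A' by the average of w', turning the order of the factors
by self-adjointness: the A_p double integral appears. -/
lemma enorm_mul_le_of_ap (hpq : p.HolderConjugate q) {c : ℝ≥0} {a : ℝ≥0∞}
    (star_w : ∀ x, star (w x) = w x) (star_w' : ∀ x, star (w' x) = w' x)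
    (star_A' : star A' = A')
    (hA : ∀ M, ‖A * M‖ₑ ≤ c * lpAvg ν p (fun x => ‖w x * M‖ₑ))
    (hA' : ∀ M, ‖A' * M‖ₑ ≤ c * lpAvg ν q (fun x => ‖w' x * M‖ₑ))
    (hap : ∫⁻ x, (∫⁻ y, ‖w x * w' y‖ₑ ^ q ∂ν) ^ (p / q) ∂ν ≤ a) :
    ‖A * A'‖ₑ ≤ c ^ 2 * a ^ (1 / p) := by
  have hp := hpq.pos
  calc _ ≤ c * lpAvg ν p (fun x => ‖w x * A'‖ₑ) := hA A'
    _ ≤ c * lpAvg ν p (fun x => c * lpAvg ν q (fun y => ‖w x * w' y‖ₑ)) := by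
        gcongr
        refine lpAvg_mono hp fun x => ?_
        rw [enorm_mul_comm_of_star (star_w x) star_A']
        refine (hA' (w x)).trans_eq ?_
        simp only [enorm_mul_comm_of_star (star_w' _) (star_w x)]
    _ = c ^ 2 * lpAvg ν p (fun x => lpAvg ν q (fun y => ‖w x * w' y‖ₑ)) := by
        rw [lpAvg_const_mul' hp ENNReal.coe_ne_top]
        ring
    _ ≤ _ := by
        gcongr
        refine ENNReal.rpow_le_rpow (le_trans (le_of_eq ?_) hap) (by positivity)
        refine lintegral_congr fun x => ?_
        simp only [lpAvg]
        rw [← ENNReal.rpow_mul, one_div_mul_eq_div]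

end Reduction

/-! ### Dual pairs from A_p weights. -/

section DualWeights

variable {n m d : ℕ} {p : ℝ}

/-- The exponents multiply to -1/p, so W' taken at p' yields the pointwise inverse of W^{1/p}. -/
lemma mpow_dualWeight {W : (Fin n → ℝ) × (Fin m → ℝ) → Matrix (Fin d) (Fin d) ℂ} (hp : 1 < p)
    {x : (Fin n → ℝ) × (Fin m → ℝ)} (hx : (W x).PosDef) :
    mpow (dualWeight p W x) (1 / p.conjExponent) = mpow (W x) (-1 / p) := by
  have h1 : p - 1 ≠ 0 := by linarith
  have h2 : p ≠ 0 := by linarith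
  rw [dualWeight, mpow_mpow hx, Real.conjExponent]
  congr 1
  field_simp

/-- Reducing operators of an `A_p` weight and of its dual weight form a dual pair. -/
theorem isDualPair_of_isReducingOperator (hp : 1 < p)
    {D : Set (Set ((Fin n → ℝ) × (Fin m → ℝ)))}
    {W : (Fin n → ℝ) × (Fin m → ℝ) → Matrix (Fin d) (Fin d) ℂ} (hW : IsDyadicAp D p W)
    {R : Set ((Fin n → ℝ) × (Fin m → ℝ))} (hR : R ∈ D)
    {A A' : Matrix (Fin d) (Fin d) ℂ} (hA : IsReducingOperator p W R A)
    (hA' : IsReducingOperator p.conjExponent (dualWeight p W) R A') :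
    IsDualPair (avgMeasure volume R) p p.conjExponent (apConst d p (apChar D p W))
      (fun x => mpow (W x) (1 / p)) (fun x => mpow (W x) (-1 / p)) A A' := by
  have hpq : p.HolderConjugate p.conjExponent := Real.HolderConjugate.conjExponent hp
  have hac : avgMeasure volume R ≪ volume :=
    avgMeasure_absolutelyContinuous.trans Measure.restrict_le_self.absolutelyContinuous
  have hpos : ∀ᵐ x ∂(avgMeasure volume R), (W x).PosDef := hac.ae_le hW.1.2
  have hmeas : AEStronglyMeasurable W (avgMeasure volume R) :=
    hW.1.1.aestronglyMeasurable.mono_ac hac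
  have hw := aestronglyMeasurable_mpow hmeas hpos (1 / p)
  have hw' := aestronglyMeasurable_mpow hmeas hpos (-1 / p)
  have hc : (reductionConst d : ℝ≥0∞) ≤ apConst d p (apChar D p W) := by
    unfold apConst
    exact_mod_cast le_self_add
  have hdual : ∀ e : EuclideanSpace ℂ (Fin d),
      lpAvg (avgMeasure volume R) p.conjExponent
        (fun x => ‖Matrix.toEuclideanCLM (𝕜 := ℂ) (mpow (dualWeight p W x)
          (1 / p.conjExponent)) e‖ₑ)
      = lpAvg (avgMeasure volume R) p.conjExponent
        (fun x => ‖Matrix.toEuclideanCLM (𝕜 := ℂ) (mpow (W x) (-1 / p)) e‖ₑ) := fun e => by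
    refine lpAvg_congr_ae ?_
    filter_upwards [hpos] with x hx
    rw [mpow_dualWeight hp hx]
  have hA'1 : ∀ e : EuclideanSpace ℂ (Fin d), _ := fun e => (hdual e).symm.le.trans (hA'.2 e).1
  have hA'2 : ∀ e : EuclideanSpace ℂ (Fin d), _ := fun e =>
    (hA'.2 e).2.trans (mul_le_mul_right (hdual e).le _)
  have e1 := lpAvg_mul_le_of_reducing hpq.lt.le hw fun e => (hA.2 e).1
  have e2 := enorm_mul_le_of_reducing hpq.pos fun e => (hA.2 e).2
  have e3 := lpAvg_mul_le_of_reducing hpq.symm.lt.le hw' hA'1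
  have e4 := enorm_mul_le_of_reducing hpq.symm.pos hA'2
  have hdet : ∀ {M : Matrix (Fin d) (Fin d) ℂ}, M.PosDef → M * M⁻¹ = 1 := fun {M} hM =>
    Matrix.mul_nonsing_inv _ ((Matrix.isUnit_iff_isUnit_det _).1 hM.isUnit)
  refine ⟨hpq, hw, hw', fun x => isSelfAdjoint_mpow _ _, fun x => isSelfAdjoint_mpow _ _, ?_,
    hA.1.isHermitian, hA'.1.isHermitian, hdet hA.1, hdet hA'.1,
    fun M => (e1 M).trans (mul_le_mul_left hc _), fun M => (e2 M).trans (mul_le_mul_left hc _),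
    fun M => (e3 M).trans (mul_le_mul_left hc _), fun M => (e4 M).trans (mul_le_mul_left hc _), ?_⟩
  · filter_upwards [hpos] with x hx
    rw [neg_div]
    exact mpow_mul_mpow_neg hx _
  · have hap : ∫⁻ x, (∫⁻ y, ‖mpow (W x) (1 / p) * mpow (W y) (-1 / p)‖ₑ ^ p.conjExponent
        ∂(avgMeasure volume R)) ^ (p / p.conjExponent) ∂(avgMeasure volume R) ≤ apChar D p W :=
      le_iSup₂ (f := fun R (_ : R ∈ D) => ⨍⁻ x in R, (⨍⁻ y in R,
        ‖mpow (W x) (1 / p) * mpow (W y) (-1 / p)‖ₑ ^ p.conjExponent ∂volume)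
          ^ (p / p.conjExponent) ∂volume) R hR
    refine (enorm_mul_le_of_ap hpq (fun x => isSelfAdjoint_mpow _ _)
      (fun x => isSelfAdjoint_mpow _ _) hA'.1.isHermitian e2 e4 hap).trans ?_
    unfold apConst
    rw [ENNReal.coe_add, ENNReal.coe_mul, ENNReal.coe_rpow_of_nonneg _
      (by have := hpq.pos; positivity), ENNReal.coe_toNNReal hW.2.ne, ENNReal.coe_pow]
    exact le_add_self

end DualWeights

/-! ### The comparisons between the norms. -/

section Norms

lemma iSup_le_mul_iSup {X : Type*} {D : Set (Set X)} {f g : Set X → ℝ≥0∞} {c : ℝ≥0∞} (h : ∀ R ∈ D, f R ≤ c * g R) :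
    ⨆ R ∈ D, f R ≤ c * ⨆ R ∈ D, g R :=
  iSup₂_le fun R hR => (h R hR).trans (mul_le_mul_right (le_iSup₂ (f := fun R _ => g R) R hR) _)

variable {X : Type*} [MeasurableSpace X] {μ : Measure X} {d : ℕ}

/-- The supremum over `D` of the weighted `Lᵖ` oscillations. -/
noncomputable def oscNorm (μ : Measure X) (D : Set (Set X)) (p : ℝ)
    (𝒰 : Set X → Matrix (Fin d) (Fin d) ℂ) (v B : X → Matrix (Fin d) (Fin d) ℂ) : ℝ≥0∞ :=
  ⨆ R ∈ D, lpAvg (avgMeasure μ R) p (fun x => ‖v x * (B x - mean μ B R) * (𝒰 R)⁻¹‖ₑ)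

/-- The supremum over `D` of the reduced mean oscillations. -/
noncomputable def reducedNorm (μ : Measure X) (D : Set (Set X))
    (𝒰 𝒱 : Set X → Matrix (Fin d) (Fin d) ℂ) (B : X → Matrix (Fin d) (Fin d) ℂ) : ℝ≥0∞ :=
  ⨆ R ∈ D, ∫⁻ x, ‖𝒱 R * (B x - mean μ B R) * (𝒰 R)⁻¹‖ₑ ∂(avgMeasure μ R)

/-- The supremum over `D` of the weighted double oscillations. -/
noncomputable def doubleNorm (μ : Measure X) (D : Set (Set X)) (p q : ℝ)
    (v u' B : X → Matrix (Fin d) (Fin d) ℂ) : ℝ≥0∞ :=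
  ⨆ R ∈ D, lpAvg (avgMeasure μ R) p (fun x => lpAvg (avgMeasure μ R) q
    (fun y => ‖v x * (B x - B y) * u' y‖ₑ))

variable {D : Set (Set X)} {p q : ℝ} {cU cV Λ : ℝ≥0}
  {u u' v v' B : X → Matrix (Fin d) (Fin d) ℂ} {𝒰 𝒰' 𝒱 𝒱' : Set X → Matrix (Fin d) (Fin d) ℂ}

/-- The standing assumptions on two weights, with their reducing operators, and on `B`: every set
of `D` is the root of a cell tree in `D` that differentiates `B`. -/
structure IsTwoWeightSetting (μ : Measure X) (D : Set (Set X)) (Λ : ℝ≥0) (p q : ℝ) (cU cV : ℝ≥0)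
    (u u' v v' B : X → Matrix (Fin d) (Fin d) ℂ)
    (𝒰 𝒰' 𝒱 𝒱' : Set X → Matrix (Fin d) (Fin d) ℂ) : Prop where
  dualU : ∀ R ∈ D, IsDualPair (avgMeasure μ R) p q cU u u' (𝒰 R) (𝒰' R)
  dualV : ∀ R ∈ D, IsDualPair (avgMeasure μ R) p q cV v v' (𝒱 R) (𝒱' R)
  tree : ∀ R ∈ D, ∃ cell, IsCellTree μ cell Λ ∧ (∀ N x, cell N x ∈ D) ∧ (∃ x, cell 0 x = R) ∧
    (∀ N x, IntegrableOn B (cell N x) μ) ∧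
    ∀ᵐ z ∂μ, Filter.Tendsto (fun N => mean μ B (cell N z)) Filter.atTop (nhds (B z))

lemma mean_star (μ : Measure X) (B : X → Matrix (Fin d) (Fin d) ℂ) (R : Set X) :
    mean μ (fun x => star (B x)) R = star (mean μ B R) :=
  (starL' ℝ : Matrix (Fin d) (Fin d) ℂ ≃L[ℝ] Matrix (Fin d) (Fin d) ℂ).integral_comp_comm B

namespace IsTwoWeightSetting

/-- The constant of the John–Nirenberg inequality for the norms. -/
noncomputable def jnNormConst (p : ℝ) (Λ cU cV : ℝ≥0) : ℝ≥0 := jnConst p Λ cU cV * cU + 1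

lemma dual (h : IsTwoWeightSetting μ D Λ p q cU cV u u' v v' B 𝒰 𝒰' 𝒱 𝒱') :
    IsTwoWeightSetting μ D Λ q p cV cU v' v u' u (fun x => star (B x)) 𝒱' 𝒱 𝒰' 𝒰 where
  dualU R hR := (h.dualV R hR).symm
  dualV R hR := (h.dualU R hR).symm
  tree R hR := by
    obtain ⟨cell, h1, h2, h3, h4, h5⟩ := h.tree R hR
    refine ⟨cell, h1, h2, h3, fun N x => ?_, ?_⟩
    · exact (starL' ℝ : Matrix (Fin d) (Fin d) ℂ ≃L[ℝ] Matrix (Fin d) (Fin d) ℂ).integrable_comp_iff.2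
        (h4 N x)
    · filter_upwards [h5] with z hz
      simp only [mean_star]
      exact hz.star

lemma measure_ne (h : IsTwoWeightSetting μ D Λ p q cU cV u u' v v' B 𝒰 𝒰' 𝒱 𝒱') {R : Set X}
    (hR : R ∈ D) : IsProbabilityMeasure (avgMeasure μ R) ∧ Integrable B (avgMeasure μ R) := by
  obtain ⟨cell, h1, h2, ⟨x, rfl⟩, h4, h5⟩ := h.tree R hR
  exact ⟨isProbabilityMeasure_avgMeasure (h1.measure_ne_zero 0 x) (h1.measure_ne_top 0 x),
    integrable_avgMeasure (h1.measure_ne_zero 0 x) (h4 0 x)⟩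

lemma oscNorm_le_reducedNorm (h : IsTwoWeightSetting μ D Λ p q cU cV u u' v v' B 𝒰 𝒰' 𝒱 𝒱') :
    oscNorm μ D p 𝒰 v B ≤ jnNormConst p Λ cU cV * reducedNorm μ D 𝒰 𝒱 B := by
  refine iSup₂_le fun R hR => ?_
  obtain ⟨cell, h1, h2, ⟨x, rfl⟩, h4, h5⟩ := h.tree R hR
  -- The summand 1 in the constant makes it nonzero, so that it can be divided out.
  have hne : (jnNormConst p Λ cU cV : ℝ≥0∞) ≠ 0 := by
    unfold jnNormConst
    positivity
  rw [mul_comm, ← ENNReal.div_le_iff hne ENNReal.coe_ne_top]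
  -- John–Nirenberg needs a finite β > 0, so it is applied to every β above the reduced norm, which
  -- may be 0.
  refine le_of_forall_gt_imp_ge_of_dense fun β hβ => ?_
  rcases eq_or_ne β ∞ with rfl | hβ1
  · exact le_top
  lift β to ℝ≥0 using hβ1
  have hβ0 : 0 < β := by exact_mod_cast (zero_le).trans_lt hβ
  rw [ENNReal.div_le_iff hne ENNReal.coe_ne_top]
  refine (lpAvg_sub_mean_le_of_cellTree h1 (fun N y => h.dualV _ (h2 N y))
    (fun N y => h.dualU _ (h2 N y)) h4 h5 hβ0 (fun N y => ?_) x).trans ?_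
  · exact (le_iSup₂ (f := fun R (_ : R ∈ D) =>
      ∫⁻ x, ‖𝒱 R * (B x - mean μ B R) * (𝒰 R)⁻¹‖ₑ ∂(avgMeasure μ R)) _ (h2 N y)).trans hβ.le
  · rw [mul_right_comm, mul_comm]
    unfold jnNormConst
    push_cast
    gcongr
    exact le_self_add

lemma reducedNorm_le_oscNorm (h : IsTwoWeightSetting μ D Λ p q cU cV u u' v v' B 𝒰 𝒰' 𝒱 𝒱') :
    reducedNorm μ D 𝒰 𝒱 B ≤ (cV ^ 2 : ℝ≥0) * oscNorm μ D p 𝒰 v B := by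
  refine iSup_le_mul_iSup fun R hR => ?_
  obtain ⟨_, hB⟩ := h.measure_ne hR
  have := (h.dualV R hR).lintegral_mul_le (F := fun x => (B x - mean μ B R) * (𝒰 R)⁻¹)
    ((hB.aestronglyMeasurable.sub aestronglyMeasurable_const).mul_const _)
  simp only [← mul_assoc] at this
  rw [sq]
  exact_mod_cast this

lemma reducedNorm_dual_le (h : IsTwoWeightSetting μ D Λ p q cU cV u u' v v' B 𝒰 𝒰' 𝒱 𝒱') :
    reducedNorm μ D 𝒱' 𝒰' (fun x => star (B x))
      ≤ (cV ^ 2 * cU : ℝ≥0) * reducedNorm μ D 𝒰 𝒱 B := by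
  refine iSup_le_mul_iSup fun R hR => ?_
  obtain ⟨_, hB⟩ := h.measure_ne hR
  rw [← lintegral_const_mul' _ _ ENNReal.coe_ne_top]
  refine lintegral_mono fun x => ?_
  rw [mean_star, ← star_sub, sq]
  exact_mod_cast (h.dualV R hR).enorm_dual_le (h.dualU R hR) _

lemma oscNorm_le_doubleNorm (h : IsTwoWeightSetting μ D Λ p q cU cV u u' v v' B 𝒰 𝒰' 𝒱 𝒱') :
    oscNorm μ D p 𝒰 v B ≤ cU * doubleNorm μ D p q v u' B := by
  refine iSup_le_mul_iSup fun R hR => ?_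
  obtain ⟨_, hB⟩ := h.measure_ne hR
  exact (h.dualU R hR).lpAvg_sub_mean_le hB v

lemma doubleNorm_le (h : IsTwoWeightSetting μ D Λ p q cU cV u u' v v' B 𝒰 𝒰' 𝒱 𝒱') :
    doubleNorm μ D p q v u' B ≤ (cU ^ 2 : ℝ≥0) * oscNorm μ D p 𝒰 v B
      + (cV ^ 2 : ℝ≥0) * oscNorm μ D q 𝒱' u' (fun x => star (B x)) := by
  refine iSup₂_le fun R hR => ?_
  obtain ⟨_, hB⟩ := h.measure_ne hR
  refine ((h.dualV R hR).lpAvg_lpAvg_le (h.dualU R hR) hB.aestronglyMeasurable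
    (mean μ B R)).trans ?_
  rw [sq, sq, ENNReal.coe_mul, ENNReal.coe_mul, ← mean_star]
  exact add_le_add
    (mul_le_mul_right (le_iSup₂ (f := fun R (_ : R ∈ D) => lpAvg (avgMeasure μ R) p
      (fun x => ‖v x * (B x - mean μ B R) * (𝒰 R)⁻¹‖ₑ)) R hR) _)
    (mul_le_mul_right (le_iSup₂ (f := fun R (_ : R ∈ D) => lpAvg (avgMeasure μ R) q
      (fun x => ‖u' x * (star (B x) - mean μ (fun x => star (B x)) R) * (𝒱' R)⁻¹‖ₑ)) R hR) _)

/-- The constant that controls `oscNorm` of `B` by that of its adjoint. -/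
noncomputable def dualOscConst (p : ℝ) (Λ cU cV : ℝ≥0) : ℝ≥0 :=
  jnNormConst p Λ cU cV * ((cU ^ 2 * cV) * cU ^ 2)

lemma reducedNorm_le_dual (h : IsTwoWeightSetting μ D Λ p q cU cV u u' v v' B 𝒰 𝒰' 𝒱 𝒱') :
    reducedNorm μ D 𝒰 𝒱 B
      ≤ (cU ^ 2 * cV : ℝ≥0) * reducedNorm μ D 𝒱' 𝒰' (fun x => star (B x)) := by
  have := h.dual.reducedNorm_dual_le
  simpa only [star_star] using this

lemma reducedNorm_le_oscNorm_dual
    (h : IsTwoWeightSetting μ D Λ p q cU cV u u' v v' B 𝒰 𝒰' 𝒱 𝒱') :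
    reducedNorm μ D 𝒰 𝒱 B
      ≤ ((cU ^ 2 * cV) * cU ^ 2 : ℝ≥0) * oscNorm μ D q 𝒱' u' (fun x => star (B x)) := by
  rw [ENNReal.coe_mul, mul_assoc]
  exact h.reducedNorm_le_dual.trans (mul_le_mul_right h.dual.reducedNorm_le_oscNorm _)

/-- John–Nirenberg for B, then the exchange of reduced norms, then Hölder for the adjoint. -/
lemma oscNorm_le_oscNorm_dual (h : IsTwoWeightSetting μ D Λ p q cU cV u u' v v' B 𝒰 𝒰' 𝒱 𝒱') :
    oscNorm μ D p 𝒰 v B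
      ≤ dualOscConst p Λ cU cV * oscNorm μ D q 𝒱' u' (fun x => star (B x)) := by
  rw [dualOscConst, ENNReal.coe_mul, mul_assoc]
  exact h.oscNorm_le_reducedNorm.trans (mul_le_mul_right h.reducedNorm_le_oscNorm_dual _)

lemma oscNorm_dual_le_oscNorm (h : IsTwoWeightSetting μ D Λ p q cU cV u u' v v' B 𝒰 𝒰' 𝒱 𝒱') :
    oscNorm μ D q 𝒱' u' (fun x => star (B x))
      ≤ dualOscConst q Λ cV cU * oscNorm μ D p 𝒰 v B := by
  have := h.dual.oscNorm_le_oscNorm_dual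
  simpa only [star_star] using this

lemma oscNorm_dual_le_reducedNorm
    (h : IsTwoWeightSetting μ D Λ p q cU cV u u' v v' B 𝒰 𝒰' 𝒱 𝒱') :
    oscNorm μ D q 𝒱' u' (fun x => star (B x))
      ≤ (jnNormConst q Λ cV cU * (cV ^ 2 * cU) : ℝ≥0) * reducedNorm μ D 𝒰 𝒱 B := by
  rw [ENNReal.coe_mul, mul_assoc]
  exact h.dual.oscNorm_le_reducedNorm.trans (mul_le_mul_right h.reducedNorm_dual_le _)

lemma doubleNorm_le_oscNorm (h : IsTwoWeightSetting μ D Λ p q cU cV u u' v v' B 𝒰 𝒰' 𝒱 𝒱') :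
    doubleNorm μ D p q v u' B
      ≤ (cU ^ 2 + cV ^ 2 * dualOscConst q Λ cV cU : ℝ≥0) * oscNorm μ D p 𝒰 v B := by
  rw [ENNReal.coe_add, ENNReal.coe_mul (cV ^ 2), add_mul, mul_assoc]
  exact h.doubleNorm_le.trans (add_le_add le_rfl (mul_le_mul_right h.oscNorm_dual_le_oscNorm _))

/-- The constant that controls `doubleNorm` of `B` by that of its adjoint. -/
noncomputable def dualDoubleConst (p q : ℝ) (Λ cU cV : ℝ≥0) : ℝ≥0 :=
  (cU ^ 2 + cV ^ 2 * dualOscConst q Λ cV cU) * (dualOscConst p Λ cU cV * cV)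

/-- The detour runs through the two single oscillations, of B and then of its adjoint. -/
lemma doubleNorm_le_dual (h : IsTwoWeightSetting μ D Λ p q cU cV u u' v v' B 𝒰 𝒰' 𝒱 𝒱') :
    doubleNorm μ D p q v u' B
      ≤ dualDoubleConst p q Λ cU cV * doubleNorm μ D q p u' v (fun x => star (B x)) := by
  rw [dualDoubleConst, ENNReal.coe_mul, mul_assoc, ENNReal.coe_mul, mul_assoc]
  exact h.doubleNorm_le_oscNorm.trans (mul_le_mul_right (h.oscNorm_le_oscNorm_dual.trans
    (mul_le_mul_right h.dual.oscNorm_le_doubleNorm _)) _)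

lemma doubleNorm_dual_le (h : IsTwoWeightSetting μ D Λ p q cU cV u u' v v' B 𝒰 𝒰' 𝒱 𝒱') :
    doubleNorm μ D q p u' v (fun x => star (B x))
      ≤ dualDoubleConst q p Λ cV cU * doubleNorm μ D p q v u' B := by
  have := h.dual.doubleNorm_le_dual
  simpa only [star_star] using this

/-- A common constant for all the comparisons. -/
noncomputable def normConst (p q : ℝ) (Λ cU cV : ℝ≥0) : ℝ≥0 :=
  [dualOscConst p Λ cU cV, dualOscConst q Λ cV cU, jnNormConst q Λ cV cU * (cV ^ 2 * cU),
    (cU ^ 2 * cV) * cU ^ 2, cU ^ 2 * cV, cV ^ 2 * cU, cU,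
    cU ^ 2 + cV ^ 2 * dualOscConst q Λ cV cU, dualDoubleConst p q Λ cU cV,
    dualDoubleConst q p Λ cV cU].sum

lemma le_normConst_mul {x y : ℝ≥0∞} {c : ℝ≥0} {l : List ℝ≥0} (hc : c ∈ l) (h : x ≤ c * y) :
    x ≤ (l.sum : ℝ≥0) * y :=
  h.trans (mul_le_mul_left (ENNReal.coe_le_coe.2 (List.single_le_sum (fun _ _ => zero_le) c hc)) y)

theorem comparable_norms (h : IsTwoWeightSetting μ D Λ p q cU cV u u' v v' B 𝒰 𝒰' 𝒱 𝒱') :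
    (Comparable (normConst p q Λ cU cV) (oscNorm μ D p 𝒰 v B)
        (oscNorm μ D q 𝒱' u' (fun x => star (B x))) ∧
      Comparable (normConst p q Λ cU cV) (oscNorm μ D q 𝒱' u' (fun x => star (B x)))
        (reducedNorm μ D 𝒰 𝒱 B) ∧
      Comparable (normConst p q Λ cU cV) (reducedNorm μ D 𝒰 𝒱 B)
        (reducedNorm μ D 𝒱' 𝒰' (fun x => star (B x)))) ∧
    (Comparable (normConst p q Λ cU cV) (oscNorm μ D p 𝒰 v B) (doubleNorm μ D p q v u' B) ∧
      Comparable (normConst p q Λ cU cV) (doubleNorm μ D p q v u' B)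
        (doubleNorm μ D q p u' v (fun x => star (B x)))) := by
  unfold normConst
  exact ⟨⟨⟨le_normConst_mul (by simp) h.oscNorm_le_oscNorm_dual,
      le_normConst_mul (by simp) h.oscNorm_dual_le_oscNorm⟩,
    ⟨le_normConst_mul (by simp) h.oscNorm_dual_le_reducedNorm,
      le_normConst_mul (by simp) h.reducedNorm_le_oscNorm_dual⟩,
    ⟨le_normConst_mul (by simp) h.reducedNorm_le_dual,
      le_normConst_mul (by simp) h.reducedNorm_dual_le⟩⟩,
    ⟨le_normConst_mul (by simp) h.oscNorm_le_doubleNorm,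
      le_normConst_mul (by simp) h.doubleNorm_le_oscNorm⟩,
    ⟨le_normConst_mul (by simp) h.doubleNorm_le_dual,
      le_normConst_mul (by simp) h.doubleNorm_dual_le⟩⟩

end IsTwoWeightSetting

end Norms

/-! ### The norms of the statement in terms of w and its inverse. -/

section Unfolding

variable {n m d : ℕ} {D : Set (Set ((Fin n → ℝ) × (Fin m → ℝ)))} {p : ℝ}
  {U V B : (Fin n → ℝ) × (Fin m → ℝ) → Matrix (Fin d) (Fin d) ℂ}
  {𝒰 𝒱 : Set ((Fin n → ℝ) × (Fin m → ℝ)) → Matrix (Fin d) (Fin d) ℂ}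

lemma bmo_eq : bmo D p 𝒰 V B = oscNorm volume D p 𝒰 (fun x => mpow (V x) (1 / p)) B := rfl

lemma bmoTilde_eq : bmoTilde D 𝒰 𝒱 B = reducedNorm volume D 𝒰 𝒱 B := rfl

lemma bmo_dualWeight_eq (hp : 1 < p) (hU : ∀ᵐ x, (U x).PosDef) :
    bmo D p.conjExponent 𝒱 (dualWeight p U) B
      = oscNorm volume D p.conjExponent 𝒱 (fun x => mpow (U x) (-1 / p)) B := by
  rw [bmo_eq]
  refine iSup_congr fun R => iSup_congr fun _ => lpAvg_congr_ae ?_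
  filter_upwards [(avgMeasure_absolutelyContinuous.trans
    Measure.restrict_le_self.absolutelyContinuous).ae_le hU] with x hx
  rw [mpow_dualWeight hp hx]

lemma bmoOne_eq : bmoOne D p U V B = doubleNorm volume D p p.conjExponent
    (fun x => mpow (V x) (1 / p)) (fun y => mpow (U y) (-1 / p)) B := by
  refine iSup_congr fun R => iSup_congr fun _ => congrArg (· ^ (1 / p)) (lintegral_congr fun x => ?_)
  simp only [lpAvg]
  rw [← ENNReal.rpow_mul, one_div_mul_eq_div]
  rfl

/-- Adjoints inside the norm reverse the factors, so `bmoTwo` is the first double norm of the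
adjoint for the dual data. -/
lemma bmoTwo_eq : bmoTwo D p U V B = doubleNorm volume D p.conjExponent p
    (fun y => mpow (U y) (-1 / p)) (fun x => mpow (V x) (1 / p)) (fun x => star (B x)) := by
  refine iSup_congr fun R => iSup_congr fun _ => congrArg (· ^ (1 / p.conjExponent)) (lintegral_congr fun y => ?_)
  simp only [lpAvg]
  rw [← ENNReal.rpow_mul, one_div_mul_eq_div]
  refine congrArg (· ^ (p.conjExponent / p)) (lintegral_congr fun x => ?_)
  rw [← enorm_star' (mpow (V x) (1 / p) * (B x - B y) * mpow (U y) (-1 / p)), star_mul, star_mul,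
    isSelfAdjoint_mpow, isSelfAdjoint_mpow, star_sub, ← enorm_neg, ← mul_neg, ← neg_mul, neg_sub,
    mul_assoc]

end Unfolding

end MatrixBMO

theorem mainTheorem3 (n m d : ℕ) (hn : 1 ≤ n) (hm : 1 ≤ m) (hd : 1 ≤ d) (p : ℝ) (hp : 1 < p) :
    ∃ C : ℝ≥0∞ → ℝ≥0∞ → ℝ≥0,
      ∀ (D₁ : Set (Set (Fin n → ℝ))) (D₂ : Set (Set (Fin m → ℝ))),
        MatrixBMO.IsDyadicGrid D₁ → MatrixBMO.IsDyadicGrid D₂ →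
      ∀ (D : Set (Set ((Fin n → ℝ) × (Fin m → ℝ)))), D = MatrixBMO.productGrid D₁ D₂ →
      ∀ (U V B : (Fin n → ℝ) × (Fin m → ℝ) → Matrix (Fin d) (Fin d) ℂ),
        MatrixBMO.IsDyadicAp D p U → MatrixBMO.IsDyadicAp D p V →
        LocallyIntegrable B volume →
      -- any choice of the reducing operators of `U`, `V` (for `p`) and of `U'`, `V'` (for `p'`)
      ∀ (𝒰 𝒱 𝒰' 𝒱' : Set ((Fin n → ℝ) × (Fin m → ℝ)) → Matrix (Fin d) (Fin d) ℂ),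
        MatrixBMO.IsReducingFamily D p U 𝒰 →
        MatrixBMO.IsReducingFamily D p V 𝒱 →
        MatrixBMO.IsReducingFamily D p.conjExponent (MatrixBMO.dualWeight p U) 𝒰' →
        MatrixBMO.IsReducingFamily D p.conjExponent (MatrixBMO.dualWeight p V) 𝒱' →
      (MatrixBMO.Comparable (C (MatrixBMO.apChar D p U) (MatrixBMO.apChar D p V))
          (MatrixBMO.bmo D p 𝒰 V B)
          (MatrixBMO.bmo D p.conjExponent 𝒱' (MatrixBMO.dualWeight p U) (fun x => (B x)ᴴ)) ∧
        MatrixBMO.Comparable (C (MatrixBMO.apChar D p U) (MatrixBMO.apChar D p V))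
          (MatrixBMO.bmo D p.conjExponent 𝒱' (MatrixBMO.dualWeight p U) (fun x => (B x)ᴴ))
          (MatrixBMO.bmoTilde D 𝒰 𝒱 B) ∧
        MatrixBMO.Comparable (C (MatrixBMO.apChar D p U) (MatrixBMO.apChar D p V))
          (MatrixBMO.bmoTilde D 𝒰 𝒱 B)
          (MatrixBMO.bmoTilde D 𝒱' 𝒰' (fun x => (B x)ᴴ))) ∧
      (MatrixBMO.Comparable (C (MatrixBMO.apChar D p U) (MatrixBMO.apChar D p V))
          (MatrixBMO.bmo D p 𝒰 V B) (MatrixBMO.bmoOne D p U V B) ∧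
        MatrixBMO.Comparable (C (MatrixBMO.apChar D p U) (MatrixBMO.apChar D p V))
          (MatrixBMO.bmoOne D p U V B) (MatrixBMO.bmoTwo D p U V B)) := by

  refine ⟨fun a b => MatrixBMO.IsTwoWeightSetting.normConst p p.conjExponent (2 ^ n * 2 ^ m)
    (MatrixBMO.apConst d p a) (MatrixBMO.apConst d p b), ?_⟩
  intro D₁ D₂ hD₁ hD₂ D hD U V B hU hV hB 𝒰 𝒱 𝒰' 𝒱' h𝒰 h𝒱 h𝒰' h𝒱'
  rw [MatrixBMO.bmo_eq, MatrixBMO.bmo_dualWeight_eq hp hU.1.2, MatrixBMO.bmoTilde_eq,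
    MatrixBMO.bmoTilde_eq, MatrixBMO.bmoOne_eq, MatrixBMO.bmoTwo_eq]
  -- The powers U^{1/p} and V^{-1/p} occur in none of the norms; they enter only through the dual
  -- pairs.
  refine MatrixBMO.IsTwoWeightSetting.comparable_norms (v' := fun x => MatrixBMO.mpow (V x) (-1 / p))
    (u := fun x => MatrixBMO.mpow (U x) (1 / p)) ⟨fun R hR => ?_, fun R hR => ?_, fun R hR => ?_⟩
  · exact MatrixBMO.isDualPair_of_isReducingOperator hp hU hR (h𝒰 R hR) (h𝒰' R hR)
  · exact MatrixBMO.isDualPair_of_isReducingOperator hp hV hR (h𝒱 R hR) (h𝒱' R hR)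
  · subst hD
    obtain ⟨cell, h1, h2, h3, h4⟩ := MatrixBMO.exists_cellTree hD₁ hD₂ hR
    exact ⟨cell, h1, h2, h3, h4 B hB⟩
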